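/- Let $\lambda>0$ be fixed. For each positive integer $n$ consider $n$ bins in which balls arrive in a Poisson process of rate $\lambda n$. Each arriving ball is placed in a uniformly random bin (the case $d=1$ of one random choice), and each ball has an exponential lifetime with mean $1$, after which it disappears; the arrivals, the choices, the lifetimes and the initial loads are independent, and the balls present at time $0$ have independent exponential remaining lifetimes with mean $1$. Let $X^{(n)}_t(j)$ be the number of balls in bin $j$ at time $t\ge 0$, and let $M^{(n)}_t=\max_{1\le j\le n}X^{(n)}_t(j)$ be the maximum load. Suppose that the initial load vector $X^{(n)}_0$ has the stationary distribution of the Markov process $(X^{(n)}_t)_{t\ge 0}$. "A.a.s." means "with probability tending to $1$ as $n\to\infty$". Then there is an integer-valued function $m=m(n)$, depending only on $\lambda$ and $n$, with $m(n)=(1+o(1))\frac{\ln n}{\ln\ln n}$ as $n\to\infty$, such that the following hold. (a) For each time $t\ge 0$, a.a.s. $M^{(n)}_t\in\{m(n),\,m(n)-1\}$. (b) For every constant $K>0$, a.a.s. $\displaystyle\min_{0\le t\le n^K}M^{(n)}_t\ \ge\ m(n)-3$. (c) For every constant $K>0$, a.a.s. the maximum of $M^{(n)}_t$ over $0\le t\le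 n^K$ exists, and $$\Big(\max_{0\le t\le n^K}M^{(n)}_t\Big)\frac{\ln\ln n}{\ln n}\ \longrightarrow\ K+1\quad\text{in probability as } n\to\infty .$$ -/

import Mathlib

open MeasureTheory ProbabilityTheory Filter Topology Asymptotics

universe u

/-- The primitive random variables of the one-choice immigration-death system with `n` bins.

* `initLoad ω j` is the number of balls in bin `j` at time `0`;
* `initLife j i ω` is the remaining lifetime, from time `0` on, of the `i`-th ball that is in
  bin `j` at time `0` (only the values with `i < initLoad ω j` matter);
* `gap k ω` is the time between the `(k-1)`-st and the `k`-th arrival (for `k = 0`: between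
  time `0` and the first arrival);
* `choice k ω` is the bin chosen by the `k`-th arriving ball, in which it is placed;
* `life k ω` is the lifetime of the `k`-th arriving ball. -/
structure BinSystem (n : ℕ) (Ω : Type u) where
  initLoad : Ω → Fin n → ℕ
  initLife : Fin n → ℕ → Ω → ℝ
  gap : ℕ → Ω → ℝ
  choice : ℕ → Ω → Fin n
  life : ℕ → Ω → ℝ

/-- Labels of the primitive random variables. -/
inductive Source (n : ℕ) : Type
  | initLoad : Source n
  | initLife (j : Fin n) (i : ℕ) : Source n
  | gap (k : ℕ) : Source n
  | choice (k : ℕ) : Source n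
  | life (k : ℕ) : Source n

namespace BinSystem

variable {n : ℕ} {Ω : Type u}

/-- The sigma-algebra generated by one of the primitive random variables. -/
abbrev sigmaAlg (S : BinSystem n Ω) : Source n → MeasurableSpace Ω
  | .initLoad => MeasurableSpace.comap S.initLoad inferInstance
  | .initLife j i => MeasurableSpace.comap (S.initLife j i) inferInstance
  | .gap k => MeasurableSpace.comap (S.gap k) inferInstance
  | .choice k => MeasurableSpace.comap (S.choice k) inferInstance
  | .life k => MeasurableSpace.comap (S.life k) inferInstance

/-- The time of the `k`-th arrival, `k = 0, 1, 2, …`. -/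
def arrival (S : BinSystem n Ω) (k : ℕ) (ω : Ω) : ℝ :=
  ∑ i ∈ Finset.range (k + 1), S.gap i ω

/-- The load `X_t(j)` of bin `j` at time `t ≥ 0`: the number of balls in bin `j` that were there at
time `0` and are still alive, plus the number of balls that have arrived by time `t`, were placed
in bin `j` and are still alive. (Almost surely only finitely many balls arrive by time `t`.) -/
noncomputable def load (S : BinSystem n Ω) (t : ℝ) (ω : Ω) (j : Fin n) : ℕ :=
  {i : ℕ | i < S.initLoad ω j ∧ t < S.initLife j i ω}.ncard +
    {k : ℕ | S.arrival k ω ≤ t ∧ S.choice k ω = j ∧ t < S.arrival k ω + S.life k ω}.ncard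

/-- The maximum load `M_t = max_j X_t(j)` of a bin at time `t`. -/
noncomputable def maxLoad (S : BinSystem n Ω) (t : ℝ) (ω : Ω) : ℕ :=
  Finset.univ.sup (S.load t ω)

/-- The probabilistic assumptions of the model with `d = 1`: balls arrive in a Poisson process of
rate `lam * n` (independent exponential interarrival times), each arriving ball chooses a uniformly
random bin, and balls have exponential lifetimes with mean one (by the lack of memory, so do the
remaining lifetimes of the balls present at time `0`). All these variables and the initial load
vector are independent; the law of the initial load vector is arbitrary. -/
structure IsOneChoice [MeasurableSpace Ω] (S : BinSystem n Ω) (lam : ℝ) (P : Measure Ω) : Prop where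
  measurable_initLoad : Measurable S.initLoad
  measurable_initLife : ∀ j i, Measurable (S.initLife j i)
  measurable_gap : ∀ k, Measurable (S.gap k)
  measurable_choice : ∀ k, Measurable (S.choice k)
  measurable_life : ∀ k, Measurable (S.life k)
  initLife_law : ∀ j i, P.map (S.initLife j i) = expMeasure 1
  gap_law : ∀ k, P.map (S.gap k) = expMeasure (lam * n)
  choice_law : ∀ k, P.map (S.choice k) = uniformOn Set.univ
  life_law : ∀ k, P.map (S.life k) = expMeasure 1
  indep : iIndep S.sigmaAlg P

/-- The initial load vector has the stationary distribution of the load vector process: at every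
time the load vector has the same law as at time `0`. -/
def InEquilibrium [MeasurableSpace Ω] (S : BinSystem n Ω) (P : Measure Ω) : Prop :=
  ∀ t : ℝ, 0 ≤ t → IdentDistrib (S.load t) S.initLoad P P

end BinSystem

/-- The events `E n` hold asymptotically almost surely: the probability that `E n` fails tends to
`0` as `n → ∞`, that is, the probability of `E n` tends to `1`. -/
def AAS {Ω : ℕ+ → Type u} [∀ n, MeasurableSpace (Ω n)] (P : ∀ n, Measure (Ω n))
    (E : ∀ n, Ω n → Prop) : Prop :=
  Tendsto (fun n : ℕ+ => P n {ω | ¬ E n ω}) atTop (𝓝 0)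

/-! In equilibrium the loads at a fixed time are independent Poisson(λ) variables, so about nλ^k/k!
bins have load k, and raising k by one divides this mean by about k/λ. Take m + 1 to be the first k
with nλ^k/k! below 1/√(k+1). The mean is then at most 1/√(m+2) at level m + 1 and at least of order
√m at level m - 1. A union bound from above and independence of the bins from below give (a). Since
log n ~ m log m, also m ~ log n / log log n.

For (b), cut time into slots of length 1/(m+1). Survival through a whole slot costs a ball of a full
bin a factor e^{-1/(m+1)}, hence only a constant factor for m - 3 balls. The mean at level m - 3 is
at least of order m^{5/2}, so a slot fails with probability at most exp(-Cm²), against about n^K m =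
exp(O(m log m)) slots.

For (c), a level k ~ c log n / log log n has k! = n^{c+o(1)}, and factors a^k are n^{o(1)}. Over n^K
units of time the expected number of visits to level k is thus n^{K+1-c+o(1)}. The upper bound
counts all balls seen during a unit interval; the lower bound uses only balls arriving in that
interval and alive at its end, which are independent over intervals and bins.

All laws come from one computation, the generating functional of a marked Poisson process built from
exponential gaps (`lintegral_prod_arrivals`), combined with the fact that generating functions
determine laws. They are stated in `map_aliveCount` and `map_freshCount`; equilibrium enters through
`lintegral_prod_pow_initLoad`. -/

/-! ### Generating functions determine laws on vectors of natural numbers. -/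

section GeneratingFunction

open scoped BoundedContinuousFunction ENNReal NNReal

variable {ι : Type*} [Fintype ι]

/-- The monomial `x ↦ ∏ i, z i ^ x i` as a bounded continuous function on `ι → ℕ`. -/
noncomputable def monomialBCF : (ι → unitInterval) →* ((ι → ℕ) →ᵇ ℝ) where
  toFun z := BoundedContinuousFunction.ofNormedAddCommGroup
    (fun x => ∏ i, (z i : ℝ) ^ x i) continuous_of_discreteTopology 1 (fun x => by
      rw [Real.norm_of_nonneg (Finset.prod_nonneg fun i _ => pow_nonneg (z i).2.1 _)]
      exact Finset.prod_le_one (fun i _ => pow_nonneg (z i).2.1 _)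
        (fun i _ => pow_le_one₀ (z i).2.1 (z i).2.2))
  map_one' := by ext x; simp
  map_mul' z w := by ext x; simp [mul_pow, Finset.prod_mul_distrib]

lemma monomialBCF_apply (z : ι → unitInterval) (x : ι → ℕ) :
    monomialBCF z x = ∏ i, (z i : ℝ) ^ x i := rfl

/-- A finite measure on `ι → ℕ` is determined by its probability generating function. -/
theorem ext_of_generatingFunction {μ ν : Measure (ι → ℕ)} [IsFiniteMeasure μ]
    [IsFiniteMeasure ν]
    (h : ∀ z : ι → ℝ≥0, (∀ i, z i ≤ 1) →
      ∫⁻ x, ∏ i, (z i : ℝ≥0∞) ^ x i ∂μ = ∫⁻ x, ∏ i, (z i : ℝ≥0∞) ^ x i ∂ν) : μ = ν := by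
  let A : StarSubalgebra ℝ ((ι → ℕ) →ᵇ ℝ) :=
    { Algebra.adjoin ℝ (MonoidHom.mrange (monomialBCF (ι := ι)) : Set ((ι → ℕ) →ᵇ ℝ)) with
      star_mem' := fun {a} ha => by
        rwa [show star a = a from BoundedContinuousFunction.ext fun x => star_trivial (a x)] }
  -- Monomials are closed under products, so the algebra they generate is their linear span, and
  -- integrals need only be compared on monomials.
  have hA : ∀ g : (ι → ℕ) →ᵇ ℝ, g ∈ A ↔ g ∈ Submodule.span ℝ
      (MonoidHom.mrange (monomialBCF (ι := ι)) : Set ((ι → ℕ) →ᵇ ℝ)) := by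
    intro g
    have := Algebra.adjoin_eq_span ℝ (MonoidHom.mrange (monomialBCF (ι := ι)) :
      Set ((ι → ℕ) →ᵇ ℝ))
    rw [Submonoid.closure_eq] at this
    rw [← this]; rfl
  refine ext_of_forall_mem_subalgebra_integral_eq_of_polish (𝕜 := ℝ) (A := A) ?_ ?_
  · intro x y hxy
    obtain ⟨i, hi⟩ := Function.ne_iff.1 hxy
    classical
    -- With 1/2 at a coordinate where the points differ and 1 elsewhere, the monomial sees only that
    -- coordinate, and injectively.
    let z : ι → unitInterval := Function.update 1 i ⟨1 / 2, by norm_num, by norm_num⟩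
    refine ⟨monomialBCF z, ⟨_, ⟨monomialBCF z, ?_, rfl⟩, rfl⟩, ?_⟩
    · exact (hA _).2 (Submodule.subset_span ⟨z, rfl⟩)
    · have key : ∀ x : ι → ℕ, monomialBCF z x = (1 / 2 : ℝ) ^ x i := by
        intro x
        rw [monomialBCF_apply, Finset.prod_eq_single i]
        · simp [z]
        · intro j _ hj; simp [z, hj]
        · simp
      rw [key, key]
      intro h
      exact hi (pow_right_injective₀ (by norm_num : (0 : ℝ) < 1 / 2) (by norm_num) h)
  · intro g hg
    rw [hA] at hg
    induction hg using Submodule.span_induction with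
    | mem g hg =>
      obtain ⟨z, rfl⟩ := hg
      let w : ι → ℝ≥0 := fun i => ⟨z i, (z i).2.1⟩
      have := h w (fun i => (z i).2.2)
      have conv : ∀ (μ : Measure (ι → ℕ)), ∫ x, monomialBCF z x ∂μ =
          (∫⁻ x, ∏ i, (w i : ℝ≥0∞) ^ x i ∂μ).toReal := by
        intro μ
        rw [integral_eq_lintegral_of_nonneg_ae]
        · congr 1
          refine lintegral_congr fun x => ?_
          rw [monomialBCF_apply, ENNReal.ofReal_prod_of_nonneg
            (fun i _ => pow_nonneg (z i).2.1 _)]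
          refine Finset.prod_congr rfl fun i _ => ?_
          rw [ENNReal.ofReal_pow (z i).2.1]
          congr 1
          exact (ENNReal.ofReal_eq_coe_nnreal _)
        · exact ae_of_all _ fun x => Finset.prod_nonneg fun i _ => pow_nonneg (z i).2.1 _
        · exact (monomialBCF z).continuous.aestronglyMeasurable
      rw [conv, conv, this]
    | zero => simp
    | add f g _ _ hf hg =>
      simp only [BoundedContinuousFunction.coe_add, Pi.add_apply]
      rw [integral_add (f.integrable _) (g.integrable _),
        integral_add (f.integrable _) (g.integrable _), hf, hg]
    | smul c f _ hf =>
      simp only [BoundedContinuousFunction.coe_smul, integral_smul]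
      rw [hf]

lemma lintegral_pow_poissonMeasure (r z : ℝ≥0) :
    ∫⁻ k, (z : ℝ≥0∞) ^ k ∂(poissonMeasure r) = ENNReal.ofReal (Real.exp (r * (z - 1))) := by
  rw [lintegral_countable']
  simp_rw [poissonMeasure_singleton]
  have h := (NormedSpace.expSeries_div_hasSum_exp (r * z : ℝ)).mul_left (Real.exp (-r))
  rw [← Real.exp_eq_exp_ℝ, ← Real.exp_add] at h
  rw [show (r : ℝ) * (z - 1) = -r + r * z by ring, ← h.tsum_eq, ENNReal.ofReal_tsum_of_nonneg
    (fun n => by positivity) h.summable]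
  refine tsum_congr fun k => ?_
  rw [← ENNReal.coe_pow, ← ENNReal.ofReal_coe_nnreal, ← ENNReal.ofReal_mul (by positivity)]
  congr 1
  push_cast
  rw [mul_pow]; ring

lemma lintegral_prod_pow_pi_poissonMeasure (r z : ι → ℝ≥0) :
    ∫⁻ x, ∏ i, (z i : ℝ≥0∞) ^ x i ∂(Measure.pi fun i => poissonMeasure (r i)) =
      ENNReal.ofReal (Real.exp (∑ i, r i * (z i - 1))) := by
  have hind : iIndepFun (fun i (x : ι → ℕ) => (z i : ℝ≥0∞) ^ x i)
      (Measure.pi fun i => poissonMeasure (r i)) :=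
    iIndepFun_pi (X := fun i (k : ℕ) => (z i : ℝ≥0∞) ^ k)
      (fun i => (measurable_of_countable _).aemeasurable)
  have h := lintegral_prod_eq_prod_lintegral_of_indepFun Finset.univ _ hind
    (fun i => by fun_prop)
  rw [h, Real.exp_sum, ENNReal.ofReal_prod_of_nonneg (fun i _ => (Real.exp_pos _).le)]
  refine Finset.prod_congr rfl fun i _ => ?_
  rw [← lintegral_pow_poissonMeasure]
  exact (measurePreserving_eval (fun i => poissonMeasure (r i)) i).lintegral_comp
    (measurable_of_countable (fun k : ℕ => (z i : ℝ≥0∞) ^ k))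

/-- A random vector of natural numbers whose generating function is that of independent Poisson
variables consists of independent Poisson variables. -/
theorem map_eq_pi_poissonMeasure {Ω : Type*} [MeasurableSpace Ω] {P : Measure Ω}
    [IsProbabilityMeasure P] {X : Ω → ι → ℕ} (hX : AEMeasurable X P) (r : ι → ℝ≥0)
    (h : ∀ z : ι → ℝ≥0, (∀ i, z i ≤ 1) →
      ∫⁻ ω, ∏ i, (z i : ℝ≥0∞) ^ X ω i ∂P = ENNReal.ofReal (Real.exp (∑ i, r i * (z i - 1)))) :
    P.map X = Measure.pi fun i => poissonMeasure (r i) := by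
  have := Measure.isProbabilityMeasure_map hX
  refine ext_of_generatingFunction fun z hz => ?_
  rw [lintegral_prod_pow_pi_poissonMeasure, ← h z hz,
    lintegral_map' (measurable_of_countable _).aemeasurable hX]

end GeneratingFunction

/-! ### One-step integrals for exponential gaps. -/

section PowersOfTails

open scoped ENNReal NNReal

variable {h : ℝ → ℝ} {C : ℝ}

lemma intervalIntegrable_of_bounded (hm : Measurable h) (hC : ∀ x, |h x| ≤ C) (a b : ℝ) :
    IntervalIntegrable h volume a b :=
  (intervalIntegrable_const (c := C)).mono_fun hm.aestronglyMeasurable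
    (ae_of_all _ fun x => by
      simpa using (hC x).trans (le_abs_self C))

lemma continuous_tail (hm : Measurable h) (hC : ∀ x, |h x| ≤ C) (T : ℝ) :
    Continuous fun s => ∫ x in s..T, h x := by
  have : (fun s => ∫ x in s..T, h x) = fun s => - ∫ x in T..s, h x := by
    ext s; rw [intervalIntegral.integral_symm]
  rw [this]
  exact (intervalIntegral.continuous_primitive
    (fun a b => intervalIntegrable_of_bounded hm hC a b) T).neg

/-- The tail integral is an antiderivative of -h. As h is only bounded and measurable, this holds
almost everywhere, and the fundamental theorem is applied to powers of an absolutely continuous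
function. -/
lemma integral_mul_tail_pow (hm : Measurable h) (hC : ∀ x, |h x| ≤ C) (u T : ℝ) (r : ℕ) :
    ∫ s in u..T, h s * (∫ x in s..T, h x) ^ r = (∫ x in u..T, h x) ^ (r + 1) / (r + 1) := by
  have hint := intervalIntegrable_of_bounded hm hC u T
  let F : ℝ → ℝ := fun s => ∫ x in T..s, h x
  have hF : AbsolutelyContinuousOnInterval F u T :=
    hint.absolutelyContinuousOnInterval_intervalIntegral (by simp)
  have hFp : ∀ k : ℕ, AbsolutelyContinuousOnInterval (fun s => F s ^ (k + 1)) u T := by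
    intro k
    induction k with
    | zero => simpa using hF
    | succ k ih =>
      have := ih.fun_mul hF
      simpa only [← pow_succ] using this
  have key := (hFp r).integral_deriv_eq_sub
  have hF0 : F T = 0 := by simp [F]
  have hsymm : ∀ s, ∫ x in s..T, h x = -F s := fun s => intervalIntegral.integral_symm _ _
  have hd : ∫ s in u..T, deriv (fun s => F s ^ (r + 1)) s =
      ∫ s in u..T, ((r + 1) * (-1) ^ r) * (h s * (∫ x in s..T, h x) ^ r) := by
    refine intervalIntegral.integral_congr_ae ?_
    filter_upwards [hint.ae_hasDerivAt_integral] with s hs hsu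
    have hd := hs (Set.uIoc_subset_uIcc hsu) T (by simp)
    rw [(hd.fun_pow (r + 1)).deriv, hsymm, neg_pow]
    have h1 : ((-1 : ℝ) ^ r) * (-1) ^ r = 1 := by rw [← mul_pow]; simp
    simp only [Nat.add_sub_cancel]
    push_cast
    change ((r : ℝ) + 1) * F s ^ r * h s = _
    linear_combination (-(r + 1) * F s ^ r * h s) * h1
  rw [hd, intervalIntegral.integral_const_mul, hF0] at key
  rw [hsymm, neg_pow, pow_succ (-1 : ℝ)]
  have h1 : ((-1 : ℝ) ^ r) * (-1) ^ r = 1 := by rw [← mul_pow]; simp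
  have hr : (r : ℝ) + 1 ≠ 0 := by positivity
  rw [eq_div_iff hr]
  calc _ = (-1) ^ r * ((r + 1) * (-1) ^ r * ∫ s in u..T, h s * (∫ x in s..T, h x) ^ r) := by
        linear_combination (-(r + 1) * ∫ s in u..T, h s * (∫ x in s..T, h x) ^ r) * h1
    _ = _ := by rw [key]; simp

/-- The density of exactly `k` marked arrivals in `(u, T]`, where marking thins the Poisson process
of rate `Λ` by `h`, and no other arrival. -/
noncomputable def poissonTerm (Λ : ℝ) (h : ℝ → ℝ) (T : ℝ) (k : ℕ) (u : ℝ) : ℝ≥0∞ :=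
  ENNReal.ofReal (Real.exp (-(Λ * (T - u))) * (Λ * ∫ x in u..T, h x) ^ k / k.factorial)

lemma measurable_poissonTerm (Λ : ℝ) (hm : Measurable h) (hC : ∀ x, |h x| ≤ C) (T : ℝ) (k : ℕ) :
    Measurable (poissonTerm Λ h T k) := by
  have := (continuous_tail hm hC T).measurable
  unfold poissonTerm
  fun_prop

lemma lintegral_expMeasure {r : ℝ} {f : ℝ → ℝ≥0∞} (hf : Measurable f) :
    ∫⁻ x, f x ∂(expMeasure r) =
      ∫⁻ x, (Set.Ioi (0 : ℝ)).indicator (fun x => ENNReal.ofReal (r * Real.exp (-(r * x))) * f x) x := by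
  have : expMeasure r = volume.withDensity (exponentialPDF r) := rfl
  have hm : Measurable (exponentialPDF r) := (measurable_exponentialPDFReal r).ennreal_ofReal
  rw [this, lintegral_withDensity_eq_lintegral_mul _ hm hf]
  refine lintegral_congr_ae ?_
  have h0 : ∀ᵐ x : ℝ, x ≠ 0 := by simp [ae_iff, measure_singleton]
  filter_upwards [h0] with x hx
  rcases lt_or_gt_of_ne hx with h | h
  · simp [exponentialPDF_of_neg h, h.not_gt]
  · simp [exponentialPDF_of_nonneg h.le, h]

/-- Peels off one arrival. The gap density Λe^{-Λx} and the factor e^{-Λ(T-u-x)} multiply to a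
constant in x, which leaves the integral of `integral_mul_tail_pow`. -/
lemma lintegral_poissonTerm_succ {Λ : ℝ} (hΛ : 0 < Λ) (hm : Measurable h) (h0 : ∀ x, 0 ≤ h x)
    (hC : ∀ x, |h x| ≤ C) {u T : ℝ} (huT : u ≤ T) (k : ℕ) :
    ∫⁻ x, (if u + x ≤ T then ENNReal.ofReal (h (u + x)) else 0) * poissonTerm Λ h T k (u + x)
      ∂(expMeasure Λ) = poissonTerm Λ h T (k + 1) u := by
  have hmp := measurable_poissonTerm Λ hm hC T k
  have hm1 : Measurable fun x => (if u + x ≤ T then ENNReal.ofReal (h (u + x)) else 0) := by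
    refine Measurable.ite ?_ (by fun_prop) measurable_const
    exact measurableSet_le (by fun_prop) measurable_const
  rw [lintegral_expMeasure (by fun_prop)]
  have hG : ∀ s ≤ T, 0 ≤ ∫ x in s..T, h x := fun s hs =>
    intervalIntegral.integral_nonneg hs fun x _ => h0 x
  let c : ℝ := Real.exp (-(Λ * (T - u))) * Λ ^ (k + 1) / k.factorial
  have hc : 0 ≤ c := by positivity
  let K : ℝ → ℝ≥0∞ := (Set.Ioc u T).indicator
    fun s => ENNReal.ofReal (c * (h s * (∫ x in s..T, h x) ^ k))
  calc _ = ∫⁻ x, K (u + x) := by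
        refine lintegral_congr fun x => ?_
        by_cases hx : 0 < x
        · by_cases hxT : u + x ≤ T
          · have h1 : x ∈ Set.Ioi (0 : ℝ) := hx
            have h2 : u + x ∈ Set.Ioc u T := ⟨by linarith, hxT⟩
            simp only [Set.indicator_of_mem h1, K, Set.indicator_of_mem h2, if_pos hxT, poissonTerm]
            rw [← ENNReal.ofReal_mul (h0 _), ← ENNReal.ofReal_mul (by positivity)]
            congr 1
            have : Real.exp (-(Λ * (T - u))) =
                Real.exp (-(Λ * x)) * Real.exp (-(Λ * (T - (u + x)))) := by
              rw [← Real.exp_add]; ring_nf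
            simp only [c, this, mul_pow]
            ring
          · simp [K, hxT, Set.indicator]
        · simp [K, hx, Set.indicator]
    _ = ∫⁻ s, K s := lintegral_add_left_eq_self K u
    _ = ENNReal.ofReal (∫ s in u..T, c * (h s * (∫ x in s..T, h x) ^ k)) := by
        rw [lintegral_indicator measurableSet_Ioc, intervalIntegral.integral_of_le huT,
          ofReal_integral_eq_lintegral_ofReal]
        · have hi : IntervalIntegrable (fun s => c * (h s * (∫ x in s..T, h x) ^ k)) volume u T :=
            ((intervalIntegrable_of_bounded hm hC u T).mul_continuousOn
              ((continuous_tail hm hC T).pow k).continuousOn).const_mul c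
          exact hi.1
        · filter_upwards [ae_restrict_mem measurableSet_Ioc] with s hs
          exact mul_nonneg hc (mul_nonneg (h0 s) (pow_nonneg (hG s hs.2) _))
    _ = _ := by
        rw [intervalIntegral.integral_const_mul, integral_mul_tail_pow hm hC, poissonTerm]
        congr 1
        simp only [c, Nat.factorial_succ]
        push_cast
        have : (k.factorial : ℝ) ≠ 0 := by positivity
        rw [mul_pow]
        field_simp

lemma expMeasure_Ioi {r : ℝ} (hr : 0 < r) {x : ℝ} (hx : 0 ≤ x) :
    expMeasure r (Set.Ioi x) = ENNReal.ofReal (Real.exp (-(r * x))) := by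
  have := isProbabilityMeasure_expMeasure hr
  have h := cdf_expMeasure_eq hr x
  rw [cdf_eq_real, if_pos hx] at h
  rw [← Set.compl_Iic, ← ENNReal.ofReal_toReal (measure_ne_top _ _), ← measureReal_def,
    probReal_compl_eq_one_sub measurableSet_Iic, h]
  ring_nf

lemma ae_expMeasure_pos {r : ℝ} : ∀ᵐ x ∂(expMeasure r), 0 < x := by
  rw [ae_iff, ← lintegral_indicator_one]
  · rw [lintegral_expMeasure]
    · refine (lintegral_congr fun x => ?_).trans lintegral_zero
      by_cases hx : 0 < x <;> simp [Set.indicator, hx]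
    · exact measurable_one.indicator (by measurability)
  · measurability

end PowersOfTails

/-! ### Marked Poisson processes and weights of their first arrivals. -/

section MarkedPoisson

open scoped ENNReal NNReal

/-- Integrating out a variable that is independent of a sigma-algebra. -/
lemma lintegral_mul_of_indep {Ω N V : Type*} {m mΩ : MeasurableSpace Ω} [MeasurableSpace N]
    [MeasurableSpace V]
    {P : Measure Ω} [IsProbabilityMeasure P] (hm : m ≤ mΩ) {ξ : Ω → N} (hξ : Measurable[mΩ] ξ)
    (hind : Indep m (MeasurableSpace.comap ξ inferInstance) P) {W : Ω → ℝ≥0∞} {S : Ω → V}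
    (hW : Measurable[m] W) (hS : Measurable[m] S) {B : V → N → ℝ≥0∞}
    (hB : Measurable (Function.uncurry B)) :
    ∫⁻ ω, W ω * B (S ω) (ξ ω) ∂P = ∫⁻ ω, W ω * ∫⁻ p, B (S ω) p ∂(P.map ξ) ∂P := by
  have := Measure.isProbabilityMeasure_map (μ := P) hξ.aemeasurable
  have hWS : Measurable[m] fun ω => (W ω, S ω) := hW.prodMk hS
  have hWS' : Measurable[mΩ] fun ω => (W ω, S ω) := hWS.mono hm le_rfl
  have hi : IndepFun (fun ω => (W ω, S ω)) ξ P := by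
    rw [IndepFun_iff_Indep]
    exact indep_of_indep_of_le_left hind hWS.comap_le
  have hmap := hi.map_prod_eq_prod_map_map hWS'.aemeasurable hξ.aemeasurable
  have hBm : Measurable fun q : (ℝ≥0∞ × V) × N => q.1.1 * B q.1.2 q.2 :=
    (measurable_fst.comp measurable_fst).mul
      (hB.comp ((measurable_snd.comp measurable_fst).prodMk measurable_snd))
  calc _ = ∫⁻ q, q.1.1 * B q.1.2 q.2 ∂(P.map fun ω => ((W ω, S ω), ξ ω)) := by
        rw [lintegral_map hBm (hWS'.prodMk hξ)]
    _ = ∫⁻ w, ∫⁻ p, w.1 * B w.2 p ∂(P.map ξ) ∂(P.map fun ω => (W ω, S ω)) := by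
        rw [hmap, lintegral_prod _ hBm.aemeasurable]
    _ = ∫⁻ w, w.1 * ∫⁻ p, B w.2 p ∂(P.map ξ) ∂(P.map fun ω => (W ω, S ω)) := by
        refine lintegral_congr fun w => ?_
        exact lintegral_const_mul _ (hB.comp measurable_prodMk_left)
    _ = _ := by
        rw [lintegral_map _ hWS']
        refine measurable_fst.mul ?_
        have : Measurable fun s => ∫⁻ p, B s p ∂(P.map ξ) := hB.lintegral_prod_right
        exact this.comp measurable_snd

variable {Ω M : Type*} [MeasurableSpace Ω] [MeasurableSpace M]

/-- `gap k` and `mark k` are the interarrival times and the marks of a marked Poisson process of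
rate `Λ` and mark distribution `ν`; the sigma-algebra `F k` contains the information on the first
`k` arrivals. -/
structure IsMarkedPoisson (gap : ℕ → Ω → ℝ) (mark : ℕ → Ω → M) (Λ : ℝ) (ν : Measure M)
    (F : ℕ → MeasurableSpace Ω) (P : Measure Ω) : Prop where
  le : ∀ k, F k ≤ ‹MeasurableSpace Ω›
  mono : ∀ k, F k ≤ F (k + 1)
  measurable_gap : ∀ k, Measurable[F (k + 1)] (gap k)
  measurable_mark : ∀ k, Measurable[F (k + 1)] (mark k)
  indep : ∀ k, Indep (F k) (MeasurableSpace.comap (fun ω => (gap k ω, mark k ω)) inferInstance) P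
  law : ∀ k, P.map (fun ω => (gap k ω, mark k ω)) = (expMeasure Λ).prod ν

/-- The time of the `r`-th arrival, counted from one. -/
noncomputable def arrivalSum (gap : ℕ → Ω → ℝ) (r : ℕ) (ω : Ω) : ℝ := ∑ i ∈ Finset.range r, gap i ω

/-- The product of `H` and the weights `g` of the first `r` arrivals if they happen up to
time `T`, and zero otherwise. -/
noncomputable def arrivalWeight (gap : ℕ → Ω → ℝ) (mark : ℕ → Ω → M) (g : ℝ × M → ℝ≥0∞) (T : ℝ)
    (H : Ω → ℝ≥0∞) : ℕ → Ω → ℝ≥0∞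
  | 0, ω => H ω
  | r + 1, ω => arrivalWeight gap mark g T H r ω *
      (if arrivalSum gap (r + 1) ω ≤ T then g (arrivalSum gap (r + 1) ω, mark r ω) else 0)

lemma arrivalSum_le_of_arrivalWeight_ne_zero {Ω M : Type*} {gap : ℕ → Ω → ℝ}
    {mark : ℕ → Ω → M} {g : ℝ × M → ℝ≥0∞} {T : ℝ} (hT : 0 ≤ T)
    {H : Ω → ℝ≥0∞} {r : ℕ} {ω : Ω} (h : arrivalWeight gap mark g T H r ω ≠ 0) :
    arrivalSum gap r ω ≤ T := by
  cases r with
  | zero => simpa [arrivalSum] using hT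
  | succ r =>
    by_contra hc
    exact h (by simp [arrivalWeight, hc])

namespace IsMarkedPoisson

variable {gap : ℕ → Ω → ℝ} {mark : ℕ → Ω → M} {Λ : ℝ} {ν : Measure M}
  {F : ℕ → MeasurableSpace Ω} {P : Measure Ω}

lemma measurable_arrivalSum (hp : IsMarkedPoisson gap mark Λ ν F P) (r : ℕ) :
    Measurable[F r] (arrivalSum gap r) := by
  unfold arrivalSum
  refine Finset.measurable_fun_sum _ fun i hi => ?_
  have hmono : Monotone F := monotone_nat_of_le_succ hp.mono
  exact (hp.measurable_gap i).mono (hmono (Finset.mem_range.1 hi)) le_rfl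

lemma measurable_arrivalWeight (hp : IsMarkedPoisson gap mark Λ ν F P) {g : ℝ × M → ℝ≥0∞}
    (hg : Measurable g) {T : ℝ} {H : Ω → ℝ≥0∞} (hH : Measurable[F 0] H) (r : ℕ) :
    Measurable[F r] (arrivalWeight gap mark g T H r) := by
  induction r with
  | zero => exact hH
  | succ r ih =>
    have hS := hp.measurable_arrivalSum (r + 1)
    have hm := hp.measurable_mark r
    refine Measurable.mul (ih.mono (hp.mono r) le_rfl) ?_
    refine Measurable.ite ?_ (hg.comp (hS.prodMk hm)) measurable_const
    exact hS measurableSet_Iic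

end IsMarkedPoisson

end MarkedPoisson

/-! ### The generating functional of a marked Poisson process. -/

section MarkedPoissonLaw

open scoped ENNReal NNReal

lemma arrivalSum_strictMono {Ω : Type*} {gap : ℕ → Ω → ℝ} {ω : Ω} (h : ∀ k, 0 < gap k ω) :
    StrictMono fun r => arrivalSum gap r ω := by
  refine strictMono_nat_of_lt_succ fun r => ?_
  simp only [arrivalSum, Finset.sum_range_succ]
  linarith [h r]

/-- Both sides express that exactly r arrivals occur by time T; the right side identifies their
index set with `Finset.range r` and so determines r. -/
lemma arrivalSum_window_iff {Ω : Type*} {gap : ℕ → Ω → ℝ} {ω : Ω} (h : ∀ k, 0 < gap k ω)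
    {T : ℝ} (hT : 0 ≤ T) (r : ℕ) :
    (arrivalSum gap r ω ≤ T ∧ T < arrivalSum gap (r + 1) ω) ↔
      ∀ k, arrivalSum gap (k + 1) ω ≤ T ↔ k < r := by
  have hS := arrivalSum_strictMono h
  constructor
  · rintro ⟨h1, h2⟩ k
    refine ⟨fun hk => ?_, fun hk => ((hS.monotone (Nat.succ_le_of_lt hk)).trans h1)⟩
    by_contra hc
    have := hS.monotone (show r + 1 ≤ k + 1 by omega)
    exact absurd (this.trans hk) (not_le.2 h2)
  · intro hk
    refine ⟨?_, not_le.1 fun hc => lt_irrefl _ ((hk r).1 hc)⟩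
    cases r with
    | zero => simpa [arrivalSum] using hT
    | succ r => exact (hk r).2 (Nat.lt_succ_self r)

lemma arrivalWeight_eq_prod {Ω M : Type*} {gap : ℕ → Ω → ℝ} {mark : ℕ → Ω → M}
    {g : ℝ × M → ℝ≥0∞} {T : ℝ} {H : Ω → ℝ≥0∞} {ω : Ω} (h : ∀ k, 0 < gap k ω) {r : ℕ}
    (hr : arrivalSum gap r ω ≤ T) :
    arrivalWeight gap mark g T H r ω =
      H ω * ∏ k ∈ Finset.range r, g (arrivalSum gap (k + 1) ω, mark k ω) := by
  induction r with
  | zero => simp [arrivalWeight]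
  | succ r ih =>
    have := (arrivalSum_strictMono h).monotone (Nat.le_succ r)
    rw [arrivalWeight, if_pos hr, ih (this.trans hr), Finset.prod_range_succ, mul_assoc]

variable {Ω M : Type*} [MeasurableSpace Ω] [MeasurableSpace M]

namespace IsMarkedPoisson

variable {gap : ℕ → Ω → ℝ} {mark : ℕ → Ω → M} {Λ : ℝ} {ν : Measure M}
  {F : ℕ → MeasurableSpace Ω} {P : Measure Ω}

lemma measurable_gap_mark (hp : IsMarkedPoisson gap mark Λ ν F P) (k : ℕ) :
    Measurable fun ω => (gap k ω, mark k ω) :=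
  ((hp.measurable_gap k).prodMk (hp.measurable_mark k)).mono (hp.le _) le_rfl

lemma ae_gap_pos [IsProbabilityMeasure ν] (hp : IsMarkedPoisson gap mark Λ ν F P) :
    ∀ᵐ ω ∂P, ∀ k, 0 < gap k ω := by
  rw [ae_all_iff]
  intro k
  have h := ae_expMeasure_pos (r := Λ)
  have hm : Measurable (gap k) := (hp.measurable_gap k).mono (hp.le _) le_rfl
  have hlaw : P.map (gap k) = expMeasure Λ := by
    have := hp.law k
    have h2 := congrArg (fun μ => Measure.map Prod.fst μ) this
    simp only [Measure.map_fst_prod, measure_univ, one_smul] at h2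
    rwa [Measure.map_map measurable_fst (hp.measurable_gap_mark k)] at h2
  rw [← hlaw] at h
  exact ae_of_ae_map hm.aemeasurable h

/-- Conditionally on the past, integrating out the last gap and mark trades one factor of the weight
for one more order of `poissonTerm`. Induction moves all r arrivals over, which is why k must stay
general. -/
lemma lintegral_arrivalWeight_mul_poissonTerm [IsProbabilityMeasure P] [IsProbabilityMeasure ν]
    (hp : IsMarkedPoisson gap mark Λ ν F P) (hΛ : 0 < Λ) {g : ℝ × M → ℝ≥0∞} (hg : Measurable g)
    (hg1 : ∀ q, g q ≤ 1) {T : ℝ} (hT : 0 ≤ T) {H : Ω → ℝ≥0∞} (hH : Measurable[F 0] H) (r k : ℕ) :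
    ∫⁻ ω, arrivalWeight gap mark g T H r ω *
        poissonTerm Λ (fun s => (∫⁻ m, g (s, m) ∂ν).toReal) T k (arrivalSum gap r ω) ∂P =
      (∫⁻ ω, H ω ∂P) * poissonTerm Λ (fun s => (∫⁻ m, g (s, m) ∂ν).toReal) T (r + k) 0 := by
  set h : ℝ → ℝ := fun s => (∫⁻ m, g (s, m) ∂ν).toReal with hh
  have hle : ∀ s, ∫⁻ m, g (s, m) ∂ν ≤ 1 := fun s =>
    (lintegral_mono fun m => hg1 (s, m)).trans (by simp)
  have hofReal : ∀ s, ENNReal.ofReal (h s) = ∫⁻ m, g (s, m) ∂ν := fun s =>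
    ENNReal.ofReal_toReal ((hle s).trans_lt ENNReal.one_lt_top).ne
  have hm : Measurable h := (hg.lintegral_prod_right' (ν := ν)).ennreal_toReal
  have h0 : ∀ s, 0 ≤ h s := fun s => ENNReal.toReal_nonneg
  have h1 : ∀ s, |h s| ≤ 1 := fun s => by
    rw [abs_of_nonneg (h0 s)]
    exact ENNReal.toReal_le_of_le_ofReal zero_le_one (by simpa using hle s)
  induction r generalizing k with
  | zero =>
    simp only [arrivalWeight, arrivalSum, Finset.range_zero, Finset.sum_empty, zero_add]
    exact lintegral_mul_const _ (hH.mono (hp.le 0) le_rfl)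
  | succ r ih =>
    have hpt := measurable_poissonTerm Λ hm h1 T k
    let B : ℝ → ℝ × M → ℝ≥0∞ := fun u p =>
      (if u + p.1 ≤ T then g (u + p.1, p.2) else 0) * poissonTerm Λ h T k (u + p.1)
    have hB : Measurable (Function.uncurry B) := by
      refine Measurable.mul (Measurable.ite ?_ ?_ measurable_const) ?_
      · exact measurableSet_le (by fun_prop) measurable_const
      · exact hg.comp (by fun_prop)
      · exact hpt.comp (by fun_prop)
    have hS : ∀ ω, arrivalSum gap (r + 1) ω = arrivalSum gap r ω + gap r ω := fun ω =>
      Finset.sum_range_succ _ _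
    calc _ = ∫⁻ ω, arrivalWeight gap mark g T H r ω *
          B (arrivalSum gap r ω) (gap r ω, mark r ω) ∂P := by
          refine lintegral_congr fun ω => ?_
          simp only [arrivalWeight, B, hS, mul_assoc]
      _ = ∫⁻ ω, arrivalWeight gap mark g T H r ω *
          ∫⁻ p, B (arrivalSum gap r ω) p ∂(P.map fun ω => (gap r ω, mark r ω)) ∂P :=
          lintegral_mul_of_indep (hp.le r) (hp.measurable_gap_mark r) (hp.indep r)
            (hp.measurable_arrivalWeight hg hH r) (hp.measurable_arrivalSum r) hB
      _ = ∫⁻ ω, arrivalWeight gap mark g T H r ω *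
          poissonTerm Λ h T (k + 1) (arrivalSum gap r ω) ∂P := by
          refine lintegral_congr fun ω => ?_
          -- The one-step integral needs the r-th arrival to be at most T; wherever this fails the
          -- weight vanishes.
          by_cases hW : arrivalWeight gap mark g T H r ω = 0
          · simp [hW]
          have huT := arrivalSum_le_of_arrivalWeight_ne_zero hT hW
          rw [hp.law, ← lintegral_poissonTerm_succ hΛ hm h0 h1 huT k, lintegral_prod]
          · congr 1
            refine lintegral_congr fun x => ?_
            simp only [B]
            rw [lintegral_mul_const]
            · split_ifs
              · rw [hofReal]
              · simp
            · split_ifs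
              · exact hg.comp measurable_prodMk_left
              · exact measurable_const
          · exact (hB.comp measurable_prodMk_left).aemeasurable
      _ = _ := by rw [ih (k + 1)]; congr 2; ring

/-- The case k = 0 above: `poissonTerm` of order 0 is the conditional probability that the next gap
passes T. -/
lemma lintegral_arrivalWeight_mul_window [IsProbabilityMeasure P] [IsProbabilityMeasure ν]
    (hp : IsMarkedPoisson gap mark Λ ν F P) (hΛ : 0 < Λ) {g : ℝ × M → ℝ≥0∞} (hg : Measurable g)
    (hg1 : ∀ q, g q ≤ 1) {T : ℝ} (hT : 0 ≤ T) {H : Ω → ℝ≥0∞} (hH : Measurable[F 0] H) (r : ℕ) :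
    ∫⁻ ω, arrivalWeight gap mark g T H r ω *
        (if T < arrivalSum gap (r + 1) ω then 1 else 0) ∂P =
      (∫⁻ ω, H ω ∂P) * poissonTerm Λ (fun s => (∫⁻ m, g (s, m) ∂ν).toReal) T r 0 := by
  have := lintegral_arrivalWeight_mul_poissonTerm hp hΛ hg hg1 hT hH r 0
  rw [add_zero] at this
  rw [← this]
  let B : ℝ → ℝ × M → ℝ≥0∞ := fun u p => if T < u + p.1 then 1 else 0
  have hB : Measurable (Function.uncurry B) := by
    refine Measurable.ite ?_ measurable_const measurable_const
    exact measurableSet_lt measurable_const (by fun_prop)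
  calc _ = ∫⁻ ω, arrivalWeight gap mark g T H r ω *
        B (arrivalSum gap r ω) (gap r ω, mark r ω) ∂P := by
        refine lintegral_congr fun ω => ?_
        simp only [B, arrivalSum, Finset.sum_range_succ]
    _ = ∫⁻ ω, arrivalWeight gap mark g T H r ω *
        ∫⁻ p, B (arrivalSum gap r ω) p ∂(P.map fun ω => (gap r ω, mark r ω)) ∂P :=
        lintegral_mul_of_indep (hp.le r) (hp.measurable_gap_mark r) (hp.indep r)
          (hp.measurable_arrivalWeight hg hH r) (hp.measurable_arrivalSum r) hB
    _ = _ := by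
        refine lintegral_congr fun ω => ?_
        by_cases hW : arrivalWeight gap mark g T H r ω = 0
        · simp [hW]
        have huT := arrivalSum_le_of_arrivalWeight_ne_zero hT hW
        congr 1
        have := isProbabilityMeasure_expMeasure hΛ
        rw [hp.law, lintegral_prod]
        · simp only [B, mul_one, poissonTerm, pow_zero, Nat.factorial_zero, Nat.cast_one, div_one]
          rw [← expMeasure_Ioi hΛ (by linarith), ← lintegral_indicator_one measurableSet_Ioi]
          refine lintegral_congr fun x => ?_
          simp only [Set.indicator, Set.mem_Ioi, Pi.one_apply, sub_lt_iff_lt_add']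
          split_ifs <;> simp
        · exact (hB.comp measurable_prodMk_left).aemeasurable

/-- The series of the terms `poissonTerm` is an exponential. -/
lemma _root_.tsum_poissonTerm {h : ℝ → ℝ} (h0 : ∀ x, 0 ≤ h x) (hΛ : 0 < Λ) {T : ℝ} (hT : 0 ≤ T) :
    ∑' r, poissonTerm Λ h T r 0 =
      ENNReal.ofReal (Real.exp (Λ * ((∫ x in (0 : ℝ)..T, h x) - T))) := by
  have hG : 0 ≤ ∫ x in (0 : ℝ)..T, h x := intervalIntegral.integral_nonneg hT fun x _ => h0 x
  have hs := (NormedSpace.expSeries_div_hasSum_exp (Λ * ∫ x in (0 : ℝ)..T, h x)).mul_left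
    (Real.exp (-(Λ * (T - 0))))
  rw [← Real.exp_eq_exp_ℝ, ← Real.exp_add] at hs
  rw [show Λ * ((∫ x in (0 : ℝ)..T, h x) - T) = -(Λ * (T - 0)) + Λ * ∫ x in (0 : ℝ)..T, h x by ring,
    ← hs.tsum_eq, ENNReal.ofReal_tsum_of_nonneg (fun n => by positivity) hs.summable]
  refine tsum_congr fun k => ?_
  rw [poissonTerm, mul_div_assoc]

/-- Almost surely, the number of arrivals up to time `T` is finite. -/
lemma ae_exists_window [IsProbabilityMeasure P] [IsProbabilityMeasure ν]
    (hp : IsMarkedPoisson gap mark Λ ν F P) (hΛ : 0 < Λ) {T : ℝ} (hT : 0 ≤ T) :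
    ∀ᵐ ω ∂P, ∃ r, ∀ k, arrivalSum gap (k + 1) ω ≤ T ↔ k < r := by
  let f : ℕ → Ω → ℝ≥0∞ := fun r ω => arrivalWeight gap mark 1 T 1 r ω *
    (if T < arrivalSum gap (r + 1) ω then 1 else 0)
  have hone : Measurable[F 0] (1 : Ω → ℝ≥0∞) := @measurable_one _ _ _ (F 0) _
  have hfm : ∀ r, Measurable (f r) := fun r => by
    refine ((hp.measurable_arrivalWeight measurable_one hone r).mono
      (hp.le r) le_rfl).mul (Measurable.ite ?_ measurable_const measurable_const)
    exact ((hp.measurable_arrivalSum (r + 1)).mono (hp.le _) le_rfl) measurableSet_Ioi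
  -- With trivial weights the terms are the Poisson probabilities of exactly r arrivals; total mass
  -- 1 leaves no room for infinitely many.
  have hsum : ∫⁻ ω, ∑' r, f r ω ∂P = 1 := by
    rw [lintegral_tsum fun r => (hfm r).aemeasurable]
    simp_rw [f, lintegral_arrivalWeight_mul_window hp hΛ measurable_one (fun _ => le_rfl) hT
      hone]
    rw [ENNReal.tsum_mul_left, tsum_poissonTerm (fun _ => ENNReal.toReal_nonneg) hΛ hT]
    simp
  have hle : ∀ᵐ ω ∂P, ∑' r, f r ω ≤
      Set.indicator {ω | ∃ r, f r ω ≠ 0} (fun _ => (1 : ℝ≥0∞)) ω := by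
    filter_upwards [hp.ae_gap_pos] with ω hω
    by_cases he : ∃ r, f r ω ≠ 0
    · rw [Set.indicator_of_mem (by exact he)]
      obtain ⟨r, hr⟩ := he
      have hw : ∀ r, f r ω ≠ 0 → ∀ k, arrivalSum gap (k + 1) ω ≤ T ↔ k < r := by
        intro r hr
        refine (arrivalSum_window_iff hω hT r).1
          ⟨arrivalSum_le_of_arrivalWeight_ne_zero hT (left_ne_zero_of_mul hr), ?_⟩
        by_contra hc
        exact hr (by simp [f, hc])
      rw [tsum_eq_single r]
      · have := (arrivalSum_window_iff hω hT r).2 (hw r hr)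
        simp [f, arrivalWeight_eq_prod hω this.1, this.2]
      · intro r' hr'
        by_contra hc
        have h1 := hw r hr
        have h2 := hw r' hc
        rcases lt_or_gt_of_ne hr' with h | h
        · exact lt_irrefl _ ((h2 r').1 ((h1 r').2 h))
        · exact lt_irrefl _ ((h1 r).1 ((h2 r).2 h))
    · push Not at he
      simp [he]
  have hmeas : MeasurableSet {ω | ∃ r, f r ω ≠ 0} := by
    simp only [Set.ofPred_exists]
    exact MeasurableSet.iUnion fun r => (hfm r) (measurableSet_singleton 0).compl
  have h1 : 1 ≤ P {ω | ∃ r, f r ω ≠ 0} := by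
    rw [← hsum]
    refine (lintegral_mono_ae hle).trans ?_
    rw [lintegral_indicator hmeas]; simp
  have hae : ∀ᵐ ω ∂P, ∃ r, f r ω ≠ 0 :=
    (prob_compl_eq_zero_iff hmeas).2 (le_antisymm prob_le_one h1)
  filter_upwards [hae, hp.ae_gap_pos] with ω ⟨r, hr⟩ hω
  refine ⟨r, (arrivalSum_window_iff hω hT r).1
    ⟨arrivalSum_le_of_arrivalWeight_ne_zero hT (left_ne_zero_of_mul hr), ?_⟩⟩
  by_contra hc
  exact hr (by simp [f, hc])

/-- The generating functional of a marked Poisson process. -/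
theorem lintegral_prod_arrivals [IsProbabilityMeasure P] [IsProbabilityMeasure ν]
    (hp : IsMarkedPoisson gap mark Λ ν F P) (hΛ : 0 < Λ) {g : ℝ × M → ℝ≥0∞} (hg : Measurable g)
    (hg1 : ∀ q, g q ≤ 1) {T : ℝ} (hT : 0 ≤ T) {H : Ω → ℝ≥0∞} (hH : Measurable[F 0] H)
    {Y : Ω → ℝ≥0∞}
    (hY : ∀ ω r, (∀ k, arrivalSum gap (k + 1) ω ≤ T ↔ k < r) →
      Y ω = H ω * ∏ k ∈ Finset.range r, g (arrivalSum gap (k + 1) ω, mark k ω)) :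
    ∫⁻ ω, Y ω ∂P = (∫⁻ ω, H ω ∂P) * ENNReal.ofReal (Real.exp
      (Λ * ((∫ s in (0 : ℝ)..T, (∫⁻ m, g (s, m) ∂ν).toReal) - T))) := by
  let f : ℕ → Ω → ℝ≥0∞ := fun r ω => arrivalWeight gap mark g T H r ω *
    (if T < arrivalSum gap (r + 1) ω then 1 else 0)
  have hfm : ∀ r, Measurable (f r) := fun r => by
    refine ((hp.measurable_arrivalWeight hg hH r).mono
      (hp.le r) le_rfl).mul (Measurable.ite ?_ measurable_const measurable_const)
    exact ((hp.measurable_arrivalSum (r + 1)).mono (hp.le _) le_rfl) measurableSet_Ioi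
  -- Almost surely exactly one r is the number of arrivals by time T, so a single term survives.
  have hYf : ∀ᵐ ω ∂P, Y ω = ∑' r, f r ω := by
    filter_upwards [hp.ae_gap_pos, hp.ae_exists_window hΛ hT] with ω hω ⟨r, hr⟩
    have hw := (arrivalSum_window_iff hω hT r).2 hr
    rw [tsum_eq_single r, hY ω r hr]
    · simp [f, arrivalWeight_eq_prod hω hw.1, hw.2]
    · intro r' hr'
      by_contra hc
      have h2 : ∀ k, arrivalSum gap (k + 1) ω ≤ T ↔ k < r' := by
        refine (arrivalSum_window_iff hω hT r').1
          ⟨arrivalSum_le_of_arrivalWeight_ne_zero hT (left_ne_zero_of_mul hc), ?_⟩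
        by_contra hc'
        exact hc (by simp [f, hc'])
      rcases lt_or_gt_of_ne hr' with h | h
      · exact lt_irrefl _ ((h2 r').1 ((hr r').2 h))
      · exact lt_irrefl _ ((hr r).1 ((h2 r).2 h))
  rw [lintegral_congr_ae hYf, lintegral_tsum fun r => (hfm r).aemeasurable]
  simp_rw [f, lintegral_arrivalWeight_mul_window hp hΛ hg hg1 hT hH]
  rw [ENNReal.tsum_mul_left, tsum_poissonTerm (fun _ => ENNReal.toReal_nonneg) hΛ hT]

/-- The numbers of arrivals up to time `T` in disjoint sets of times and marks have the generating
function of independent Poisson variables. -/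
theorem lintegral_mul_prod_pow_count [IsProbabilityMeasure P] [IsProbabilityMeasure ν]
    (hp : IsMarkedPoisson gap mark Λ ν F P) (hΛ : 0 < Λ) {ι : Type*} [Fintype ι]
    {A : ι → Set (ℝ × M)} (hA : ∀ i, MeasurableSet (A i))
    (hdisj : Pairwise fun i j => Disjoint (A i) (A j)) {T : ℝ} (hT : 0 ≤ T) {H : Ω → ℝ≥0∞}
    (hH : Measurable[F 0] H) {z : ι → ℝ≥0} (hz : ∀ i, z i ≤ 1) :
    ∫⁻ ω, H ω * ∏ i, (z i : ℝ≥0∞) ^ {k : ℕ | arrivalSum gap (k + 1) ω ≤ T ∧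
        (arrivalSum gap (k + 1) ω, mark k ω) ∈ A i}.ncard ∂P =
      (∫⁻ ω, H ω ∂P) * ENNReal.ofReal (Real.exp
        (∑ i, (Λ * ∫ s in (0 : ℝ)..T, ν.real {m | (s, m) ∈ A i}) * (z i - 1))) := by
  classical
  let g : ℝ × M → ℝ≥0∞ := fun q => ∏ i, if q ∈ A i then (z i : ℝ≥0∞) else 1
  have hg : Measurable g := Finset.measurable_fun_prod _ fun i _ =>
    Measurable.ite (hA i) measurable_const measurable_const
  have hg1 : ∀ q, g q ≤ 1 := fun q => Finset.prod_le_one' fun i _ => by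
    split_ifs
    · exact_mod_cast hz i
    · exact le_rfl
  have hslice : ∀ i s, MeasurableSet {m | (s, m) ∈ A i} := fun i s =>
    measurable_prodMk_left (hA i)
  -- By disjointness at most one factor of g differs from 1. The product thus becomes linear in the
  -- indicators, so the exponent splits into one summand per set: independent Poisson counts.
  have hgreal : ∀ q, (g q).toReal = 1 + ∑ i, (A i).indicator (fun _ => (z i - 1 : ℝ)) q := by
    intro q
    by_cases hq : ∃ i, q ∈ A i
    · obtain ⟨i, hi⟩ := hq
      have hj : ∀ j, j ≠ i → q ∉ A j := fun j hj hqj =>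
        Set.disjoint_left.1 (hdisj hj) hqj hi
      rw [Finset.sum_eq_single i (fun j _ h => by simp [hj j h]) (by simp)]
      simp only [g]
      rw [Finset.prod_eq_single i (fun j _ h => by simp [hj j h]) (by simp)]
      simp [hi]
    · push Not at hq
      simp [g, hq]
  have hint : ∀ s, (∫⁻ m, g (s, m) ∂ν).toReal =
      1 + ∑ i, ν.real {m | (s, m) ∈ A i} * (z i - 1) := by
    intro s
    rw [← integral_toReal]
    · simp_rw [hgreal]
      have hi : ∀ i, Integrable (fun m => (A i).indicator (fun _ => (z i - 1 : ℝ)) (s, m)) ν :=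
        fun i => (integrable_const (z i - 1 : ℝ)).indicator (hslice i s)
      rw [integral_add (integrable_const _) (integrable_finsetSum _ fun i _ => hi i),
        integral_finsetSum _ fun i _ => hi i]
      congr 1
      · simp
      · refine Finset.sum_congr rfl fun i _ => ?_
        have := integral_indicator_const (μ := ν) (z i - 1 : ℝ) (hslice i s)
        rw [smul_eq_mul] at this
        rw [← this]; rfl
    · exact (hg.comp measurable_prodMk_left).aemeasurable
    · exact ae_of_all _ fun m => (hg1 _).trans_lt ENNReal.one_lt_top
  have hmeas : ∀ i, Measurable fun s => ν.real {m | (s, m) ∈ A i} := fun i =>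
    (measurable_measure_prodMk_left (hA i)).ennreal_toReal
  have hii : ∀ i, IntervalIntegrable (fun s => ν.real {m | (s, m) ∈ A i}) volume 0 T := fun i =>
    intervalIntegrable_of_bounded (C := 1) (hmeas i) (fun s => by
      rw [abs_of_nonneg measureReal_nonneg]; exact measureReal_le_one) 0 T
  rw [hp.lintegral_prod_arrivals hΛ hg hg1 hT hH]
  · congr 3
    simp_rw [hint]
    have hsum : IntervalIntegrable (fun s => ∑ i, ν.real {m | (s, m) ∈ A i} * (z i - 1 : ℝ))
        volume 0 T := by
      have := IntervalIntegrable.sum Finset.univ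
        fun i _ => (hii i).mul_const (z i - 1 : ℝ)
      simpa only [Finset.sum_fn] using this
    rw [intervalIntegral.integral_add intervalIntegrable_const hsum,
      intervalIntegral.integral_finsetSum fun i _ => (hii i).mul_const _]
    simp only [intervalIntegral.integral_mul_const, intervalIntegral.integral_const, sub_zero,
      smul_eq_mul, mul_one, add_sub_cancel_left, Finset.mul_sum, mul_assoc]
  · intro ω r hr
    congr 1
    simp only [g]
    rw [Finset.prod_comm]
    refine Finset.prod_congr rfl fun i _ => ?_
    rw [Finset.prod_ite, Finset.prod_const, Finset.prod_const_one, mul_one]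
    congr 1
    rw [← Set.ncard_coe_finset]
    congr 1
    ext k
    simp [hr k]

end IsMarkedPoisson

end MarkedPoissonLaw

/-! ### Measurability of random counts. -/

section Counting

open scoped ENNReal NNReal

/-- The number of indices for which a random property holds is a random variable. -/
lemma measurable_ncard_setOf {Ω : Type*} {m : MeasurableSpace Ω} {p : ℕ → Ω → Prop}
    (hp : ∀ k, MeasurableSet[m] {ω | p k ω}) : Measurable[m] fun ω => {k | p k ω}.ncard := by
  -- For infinite s both sides take the default value 0.
  have h : ∀ s : Set ℕ, s.ncard = ⌊(Measure.count s).toReal⌋₊ := by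
    intro s
    rcases s.finite_or_infinite with hs | hs
    · rw [Measure.count_apply_finite s hs, Set.ncard_eq_toFinset_card s hs]
      simp
    · rw [Measure.count_apply_infinite hs, hs.ncard]
      simp
  have h2 : ∀ ω, Measure.count {k | p k ω} =
      ∑' k, {ω | p k ω}.indicator (fun _ => (1 : ℝ≥0∞)) ω := by
    intro ω
    rw [Measure.count, Measure.sum_apply _ (MeasurableSet.of_discrete)]
    refine tsum_congr fun k => ?_
    rw [Measure.dirac_apply' _ MeasurableSet.of_discrete]
    rfl
  simp_rw [h, h2]
  refine Nat.measurable_floor.comp (Measurable.ennreal_toReal ?_)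
  exact Measurable.tsum fun k => measurable_const.indicator (hp k)

lemma measurable_of_forall_eval {Ω ι : Type*} {β : ι → Type*} {m : MeasurableSpace Ω}
    [∀ i, MeasurableSpace (β i)] {f : Ω → ∀ i, β i} (hf : ∀ i, Measurable[m] fun ω => f ω i) :
    Measurable[m] f :=
  measurable_pi_lambda _ hf

end Counting

/-! ### Mean number of survivors among Poisson arrivals. -/

section SurvivalIntegral

lemma expMeasure_real_Ioi {x : ℝ} :
    (expMeasure 1).real (Set.Ioi x) = if 0 ≤ x then Real.exp (-x) else 1 := by
  have := isProbabilityMeasure_expMeasure one_pos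
  have h := cdf_expMeasure_eq one_pos x
  rw [cdf_eq_real] at h
  rw [← Set.compl_Iic, probReal_compl_eq_one_sub measurableSet_Iic, h]
  split_ifs <;> simp

lemma integral_survival_of_le {T t : ℝ} (hT : 0 ≤ T) (hTt : T ≤ t) :
    ∫ s in (0 : ℝ)..T, (expMeasure 1).real (Set.Ioi (t - s)) =
      Real.exp (-(t - T)) - Real.exp (-t) := by
  have : ∫ s in (0 : ℝ)..T, (expMeasure 1).real (Set.Ioi (t - s)) =
      ∫ s in (0 : ℝ)..T, Real.exp (-t) * Real.exp s := by
    refine intervalIntegral.integral_congr fun s hs => ?_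
    rw [Set.uIcc_of_le hT] at hs
    rw [expMeasure_real_Ioi, if_pos (by linarith [hs.2]), ← Real.exp_add]
    ring_nf
  rw [this, intervalIntegral.integral_const_mul, integral_exp, mul_sub, ← Real.exp_add]
  ring_nf
  simp

lemma intervalIntegrable_survival (t a b : ℝ) :
    IntervalIntegrable (fun s => (expMeasure 1).real (Set.Ioi (t - s))) volume a b := by
  have := isProbabilityMeasure_expMeasure one_pos
  refine intervalIntegrable_of_bounded (C := 1) ?_ (fun s => ?_) a b
  · simp_rw [expMeasure_real_Ioi]
    refine Measurable.ite ?_ (by fun_prop) measurable_const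
    exact measurableSet_le measurable_const (by fun_prop)
  · rw [abs_of_nonneg measureReal_nonneg]; exact measureReal_le_one

/-- An arrival after t is alive beyond t with certainty, so the arrivals in (t, T] contribute their
full length T - t. -/
lemma integral_survival_of_ge {T t : ℝ} (ht : 0 ≤ t) (hTt : t ≤ T) :
    ∫ s in (0 : ℝ)..T, (expMeasure 1).real (Set.Ioi (t - s)) =
      1 - Real.exp (-t) + (T - t) := by
  have h2 : ∫ s in t..T, (expMeasure 1).real (Set.Ioi (t - s)) = ∫ s in t..T, (1 : ℝ) := by
    refine intervalIntegral.integral_congr fun s hs => ?_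
    rw [Set.uIcc_of_le hTt] at hs
    rw [expMeasure_real_Ioi]
    split_ifs with h
    · have : t - s = 0 := by linarith [hs.1]
      simp [this]
    · rfl
  rw [← intervalIntegral.integral_add_adjacent_intervals (intervalIntegrable_survival t 0 t)
    (intervalIntegrable_survival t t T), integral_survival_of_le ht le_rfl, h2]
  simp

end SurvivalIntegral

/-! ### The bin system as a marked Poisson process. -/

namespace BinSystem

open scoped ENNReal NNReal

variable {n : ℕ} {Ω : Type u}

/-- The number of balls in bin `j` that are present at time `0` or arrive up to time `T`, and do
not die before time `t`. -/
noncomputable def aliveCount (S : BinSystem n Ω) (T t : ℝ) (ω : Ω) (j : Fin n) : ℕ :=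
  {i : ℕ | i < S.initLoad ω j ∧ t < S.initLife j i ω}.ncard +
    {k : ℕ | S.arrival k ω ≤ T ∧ S.choice k ω = j ∧ t < S.arrival k ω + S.life k ω}.ncard

/-- The number of balls that arrive in bin `j` in the time interval `(i, i + 1]` and are alive at
time `i + 1`, provided that they arrive up to time `T`. -/
noncomputable def freshCount (S : BinSystem n Ω) (T : ℝ) (ω : Ω) (i : ℕ) (j : Fin n) : ℕ :=
  {k : ℕ | S.arrival k ω ≤ T ∧ (i < S.arrival k ω ∧ S.arrival k ω ≤ i + 1 ∧ S.choice k ω = j ∧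
    i + 1 < S.arrival k ω + S.life k ω)}.ncard

lemma load_eq_aliveCount (S : BinSystem n Ω) (t : ℝ) : S.load t = S.aliveCount t t := rfl

/-- The sources that are used up to (and not including) the `k`-th arrival. -/
def pastSources (n k : ℕ) : Set (Source n)
  | .initLoad => True
  | .initLife _ _ => True
  | .gap i => i < k
  | .choice i => i < k
  | .life i => i < k

/-- The sigma-algebra of the initial configuration and the first `k` arrivals. -/
@[reducible] def past (S : BinSystem n Ω) (k : ℕ) : MeasurableSpace Ω :=
  ⨆ s ∈ pastSources n k, S.sigmaAlg s

lemma sigmaAlg_le_past (S : BinSystem n Ω) {k : ℕ} {s : Source n} (hs : s ∈ pastSources n k) :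
    S.sigmaAlg s ≤ S.past k :=
  le_biSup S.sigmaAlg hs

namespace IsOneChoice

variable [MeasurableSpace Ω] {S : BinSystem n Ω} {lam : ℝ} {P : Measure Ω}

lemma sigmaAlg_le (h : S.IsOneChoice lam P) (s : Source n) :
    S.sigmaAlg s ≤ ‹MeasurableSpace Ω› := by
  cases s with
  | initLoad => exact h.measurable_initLoad.comap_le
  | initLife j i => exact (h.measurable_initLife j i).comap_le
  | gap k => exact (h.measurable_gap k).comap_le
  | choice k => exact (h.measurable_choice k).comap_le
  | life k => exact (h.measurable_life k).comap_le

lemma indepFun_choice_life (h : S.IsOneChoice lam P) (k : ℕ) :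
    IndepFun (S.choice k) (S.life k) P :=
  (IndepFun_iff_Indep _ _ _).2
    (h.indep.indep (i := Source.choice k) (j := Source.life k) (by simp))

lemma indepFun_gap_mark (h : S.IsOneChoice lam P) (k : ℕ) :
    IndepFun (S.gap k) (fun ω => (S.choice k ω, S.life k ω)) P := by
  rw [IndepFun_iff_Indep]
  have hi := indep_iSup_of_disjoint h.sigmaAlg_le h.indep
    (S := {Source.gap k}) (T := {Source.choice k, Source.life k}) (by simp)
  refine indep_of_indep_of_le_left (indep_of_indep_of_le_right hi ?_) ?_
  · refine Measurable.comap_le (Measurable.prodMk ?_ ?_)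
    · exact (comap_measurable (S.choice k)).mono
        (le_biSup S.sigmaAlg (i := Source.choice k) (by simp)) le_rfl
    · exact (comap_measurable (S.life k)).mono
        (le_biSup S.sigmaAlg (i := Source.life k) (by simp)) le_rfl
  · exact le_biSup S.sigmaAlg (i := Source.gap k) (by simp)

/-- The distribution of the bin and the lifetime of a ball. -/
noncomputable def _root_.markLaw (n : ℕ) : Measure (Fin n × ℝ) :=
  (uniformOn Set.univ).prod (expMeasure 1)

lemma isMarkedPoisson [IsProbabilityMeasure P] (h : S.IsOneChoice lam P) :
    IsMarkedPoisson S.gap (fun k ω => (S.choice k ω, S.life k ω)) (lam * n) (markLaw n)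
      S.past P where
  le k := iSup₂_le fun s _ => h.sigmaAlg_le s
  mono k := biSup_mono fun s hs => by
    cases s <;> simp only [pastSources, Membership.mem, Set.Mem] at hs ⊢
    all_goals exact Nat.lt_succ_of_lt hs
  measurable_gap k := (comap_measurable (S.gap k)).mono
    (S.sigmaAlg_le_past (s := .gap k) (Nat.lt_succ_self k)) le_rfl
  measurable_mark k := ((comap_measurable (S.choice k)).mono
    (S.sigmaAlg_le_past (s := .choice k) (Nat.lt_succ_self k)) le_rfl).prodMk
    ((comap_measurable (S.life k)).mono
    (S.sigmaAlg_le_past (s := .life k) (Nat.lt_succ_self k)) le_rfl)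
  indep k := by
    have hd : Disjoint (pastSources n k) {Source.gap k, Source.choice k, Source.life k} := by
      rw [Set.disjoint_left]
      rintro s hs (rfl | rfl | rfl) <;> exact lt_irrefl k hs
    refine indep_of_indep_of_le_right
      (indep_iSup_of_disjoint h.sigmaAlg_le h.indep hd) ?_
    refine Measurable.comap_le (Measurable.prodMk ?_ (Measurable.prodMk ?_ ?_))
    · exact (comap_measurable (S.gap k)).mono
        (le_biSup S.sigmaAlg (i := Source.gap k) (by simp)) le_rfl
    · exact (comap_measurable (S.choice k)).mono
        (le_biSup S.sigmaAlg (i := Source.choice k) (by simp)) le_rfl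
    · exact (comap_measurable (S.life k)).mono
        (le_biSup S.sigmaAlg (i := Source.life k) (by simp)) le_rfl
  law k := by
    have hm := (h.measurable_choice k).prodMk (h.measurable_life k)
    rw [(h.indepFun_gap_mark k).map_prod_eq_prod_map_map (h.measurable_gap k).aemeasurable
      hm.aemeasurable, h.gap_law, (h.indepFun_choice_life k).map_prod_eq_prod_map_map
      (h.measurable_choice k).aemeasurable (h.measurable_life k).aemeasurable, h.choice_law,
      h.life_law, markLaw]

end IsOneChoice

lemma _root_.isProbabilityMeasure_markLaw (hn : 0 < n) : IsProbabilityMeasure (markLaw n) := by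
  have : Nonempty (Fin n) := ⟨⟨0, hn⟩⟩
  have := isProbabilityMeasure_expMeasure one_pos
  have : IsProbabilityMeasure (uniformOn (Set.univ : Set (Fin n))) :=
    isProbabilityMeasure_uniformOn Set.finite_univ Set.univ_nonempty
  unfold markLaw
  infer_instance

lemma _root_.markLaw_real_slice (j : Fin n) (x : ℝ) :
    (markLaw n).real {m | m.1 = j ∧ x < m.2} = (expMeasure 1).real (Set.Ioi x) / n := by
  have := isProbabilityMeasure_expMeasure one_pos
  have hs : {m : Fin n × ℝ | m.1 = j ∧ x < m.2} = {j} ×ˢ Set.Ioi x := by ext; simp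
  rw [hs, markLaw, measureReal_prod_prod, measureReal_def, uniformOn_univ]
  simp [div_eq_inv_mul]

lemma measurable_aliveCount [MeasurableSpace Ω] {S : BinSystem n Ω} {lam : ℝ} {P : Measure Ω}
    (h : S.IsOneChoice lam P) (T t : ℝ) : Measurable (S.aliveCount T t) := by
  have ha : ∀ k, Measurable (S.arrival k) := fun k =>
    Finset.measurable_fun_sum _ fun i _ => h.measurable_gap i
  refine measurable_pi_lambda _ fun j => Measurable.add ?_ ?_
  · refine measurable_ncard_setOf fun i => MeasurableSet.inter ?_ ?_
    · exact measurableSet_lt measurable_const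
        ((measurable_pi_apply j).comp h.measurable_initLoad)
    · exact measurableSet_lt measurable_const (h.measurable_initLife j i)
  · refine measurable_ncard_setOf fun k => MeasurableSet.inter ?_ (MeasurableSet.inter ?_ ?_)
    · exact measurableSet_le (ha k) measurable_const
    · exact h.measurable_choice k (measurableSet_singleton j)
    · exact measurableSet_lt measurable_const ((ha k).add (h.measurable_life k))

lemma measurable_freshCount [MeasurableSpace Ω] {S : BinSystem n Ω} {lam : ℝ} {P : Measure Ω}
    (h : S.IsOneChoice lam P) (T : ℝ) (i : ℕ) (j : Fin n) :
    Measurable (fun ω => S.freshCount T ω i j) := by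
  have ha : ∀ k, Measurable (S.arrival k) := fun k =>
    Finset.measurable_fun_sum _ fun i _ => h.measurable_gap i
  refine measurable_ncard_setOf fun k => (measurableSet_le (ha k) measurable_const).inter
    ((measurableSet_lt measurable_const (ha k)).inter
    ((measurableSet_le (ha k) measurable_const).inter
    ((h.measurable_choice k (measurableSet_singleton j)).inter
      (measurableSet_lt measurable_const ((ha k).add (h.measurable_life k))))))

end BinSystem

/-! ### Joint laws of the ball counts, and the equilibrium law. -/

namespace BinSystem

open scoped ENNReal NNReal

variable {n : ℕ} {Ω : Type u} [MeasurableSpace Ω] {S : BinSystem n Ω} {lam : ℝ} {P : Measure Ω}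

lemma measurable_prod_pow_initLoad (h : S.IsOneChoice lam P) (w : Fin n → ℝ≥0) :
    Measurable fun ω => ∏ j, (w j : ℝ≥0∞) ^ S.initLoad ω j :=
  (measurable_of_countable fun x : Fin n → ℕ => ∏ j, (w j : ℝ≥0∞) ^ x j).comp h.measurable_initLoad

variable [IsProbabilityMeasure P]

/-- The generating function of a Bernoulli variable that marks survival up to time `t`. -/
noncomputable def thinned (t : ℝ) (z : ℝ≥0) : ℝ≥0 := Real.toNNReal (1 + Real.exp (-t) * (z - 1))

lemma coe_thinned {t : ℝ} (ht : 0 ≤ t) (z : ℝ≥0) :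
    (thinned t z : ℝ) = 1 + Real.exp (-t) * (z - 1) := by
  refine Real.coe_toNNReal _ ?_
  have h1 : Real.exp (-t) ≤ 1 := Real.exp_le_one_iff.2 (by linarith)
  have h2 := Real.exp_pos (-t)
  have h3 : (0 : ℝ) ≤ z := z.2
  nlinarith [mul_nonneg h2.le h3]

lemma thinned_le_one {t : ℝ} (ht : 0 ≤ t) {z : ℝ≥0} (hz : z ≤ 1) : thinned t z ≤ 1 := by
  rw [← NNReal.coe_le_coe, coe_thinned ht]
  have h2 := Real.exp_pos (-t)
  have h3 : (z : ℝ) ≤ 1 := hz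
  push_cast
  nlinarith

lemma lintegral_ite_survival {t : ℝ} (ht : 0 ≤ t) (z : ℝ≥0) :
    ∫⁻ x, (if t < x then (z : ℝ≥0∞) else 1) ∂(expMeasure 1) = thinned t z := by
  have := isProbabilityMeasure_expMeasure one_pos
  have h1 : ∀ x : ℝ, (if t < x then (z : ℝ≥0∞) else 1) =
      (Set.Ioi t).indicator (fun _ => (z : ℝ≥0∞)) x +
      (Set.Ioi t)ᶜ.indicator (fun _ => (1 : ℝ≥0∞)) x := by
    intro x
    by_cases hx : t < x
    · simp [Set.indicator, hx, not_le.2 hx]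
    · simp [Set.indicator, hx, not_lt.1 hx]
  simp_rw [h1]
  rw [lintegral_add_left (measurable_const.indicator measurableSet_Ioi),
    lintegral_indicator_const measurableSet_Ioi,
    lintegral_indicator_const measurableSet_Ioi.compl, prob_compl_eq_one_sub measurableSet_Ioi,
    expMeasure_Ioi one_pos ht]
  rw [← ENNReal.toReal_eq_toReal_iff' (by finiteness) (by finiteness),
    ENNReal.toReal_add (by finiteness) (by finiteness)]
  have he : Real.exp (-t) ≤ 1 := Real.exp_le_one_iff.2 (by linarith)
  simp only [one_mul, ENNReal.toReal_mul, ENNReal.coe_toReal, coe_thinned ht]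
  rw [ENNReal.toReal_sub_of_le (by simpa using he) (by simp)]
  rw [ENNReal.toReal_ofReal (Real.exp_pos _).le]
  simp only [ENNReal.toReal_one]
  ring

/-- Binomial thinning: given the initial loads, each initial ball survives independently with
probability e^{-t}, so integrating out its lifetime replaces z by the Bernoulli generating function
at z. -/
lemma lintegral_prod_pow_initial (h : S.IsOneChoice lam P) {t : ℝ} (ht : 0 ≤ t) (z : Fin n → ℝ≥0) :
    ∫⁻ ω, ∏ j, (z j : ℝ≥0∞) ^ {i : ℕ | i < S.initLoad ω j ∧ t < S.initLife j i ω}.ncard ∂P =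
      ∫⁻ ω, ∏ j, (thinned t (z j) : ℝ≥0∞) ^ S.initLoad ω j ∂P := by
  let L : Ω → Fin n → ℕ → ℝ := fun ω j i => S.initLife j i ω
  have hL : Measurable L := measurable_pi_lambda _ fun j => measurable_pi_lambda _ fun i =>
    h.measurable_initLife j i
  have hind : Indep (S.sigmaAlg .initLoad) (MeasurableSpace.comap L inferInstance) P := by
    have hd : Disjoint {Source.initLoad} (Set.range fun p : Fin n × ℕ => Source.initLife p.1 p.2) := by
      simp
    have hi := indep_iSup_of_disjoint h.sigmaAlg_le h.indep hd
    refine indep_of_indep_of_le_left (indep_of_indep_of_le_right hi ?_) ?_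
    · refine Measurable.comap_le
        (measurable_of_forall_eval fun j => measurable_of_forall_eval fun i => ?_)
      exact (comap_measurable (S.initLife j i)).mono
        (le_biSup S.sigmaAlg (i := Source.initLife j i) ⟨(j, i), rfl⟩) le_rfl
    · exact le_biSup S.sigmaAlg (i := Source.initLoad) (by simp)
  let B : (Fin n → ℕ) → (Fin n → ℕ → ℝ) → ℝ≥0∞ := fun x l =>
    ∏ j, ∏ i ∈ Finset.range (x j), if t < l j i then (z j : ℝ≥0∞) else 1
  have hBx : ∀ x, Measurable (B x) := fun x =>
    Finset.measurable_fun_prod _ fun j _ => Finset.measurable_fun_prod _ fun i _ =>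
      Measurable.ite (measurableSet_lt measurable_const (by fun_prop)) measurable_const
        measurable_const
  have hB : Measurable (Function.uncurry B) := measurable_from_prod_countable_right hBx
  have hfam : iIndepFun (fun p : (Σ _ : Fin n, ℕ) => S.initLife p.1 p.2) P := by
    have := h.indep.precomp (g := fun p : (Σ _ : Fin n, ℕ) => Source.initLife p.1 p.2) (by
      rintro ⟨a, b⟩ ⟨c, d⟩ hh
      simpa using hh)
    exact (iIndepFun_iff_iIndep _ _ _).2 this
  have hfix : ∀ x, ∫⁻ l, B x l ∂(P.map L) = ∏ j, (thinned t (z j) : ℝ≥0∞) ^ x j := by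
    intro x
    rw [lintegral_map (hBx x) hL]
    have hm : ∀ j : Fin n, Measurable fun y : ℝ => if t < y then (z j : ℝ≥0∞) else 1 := fun j =>
      Measurable.ite measurableSet_Ioi measurable_const measurable_const
    have hc := hfam.comp (g := fun (p : Σ _ : Fin n, ℕ) (y : ℝ) => if t < y then (z p.1 : ℝ≥0∞) else 1)
      (fun p => hm p.1)
    have hp := lintegral_prod_eq_prod_lintegral_of_indepFun
      (Finset.univ.sigma fun j => Finset.range (x j)) _ hc
      (fun p => (hm p.1).comp (h.measurable_initLife p.1 p.2))
    simp only [Finset.prod_sigma] at hp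
    refine Eq.trans ?_ (hp.trans ?_)
    · rfl
    · refine Finset.prod_congr rfl fun j _ => ?_
      have : ∀ i, ∫⁻ ω, (if t < S.initLife j i ω then (z j : ℝ≥0∞) else 1) ∂P =
          thinned t (z j) := by
        intro i
        rw [← lintegral_ite_survival ht, ← h.initLife_law j i,
          lintegral_map (hm j) (h.measurable_initLife j i)]
      simp only [Function.comp_apply]
      rw [Finset.prod_congr rfl fun i _ => this i]
      simp
  have key := lintegral_mul_of_indep (P := P) (W := 1) (h.sigmaAlg_le .initLoad) hL hind
    (@measurable_one _ _ _ (S.sigmaAlg .initLoad) _) (comap_measurable S.initLoad) hB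
  simp only [Pi.one_apply, one_mul, hfix] at key
  rw [← key]
  refine lintegral_congr fun ω => Finset.prod_congr rfl fun j _ => ?_
  rw [Finset.prod_ite, Finset.prod_const, Finset.prod_const_one, mul_one, ← Set.ncard_coe_finset]
  congr 2
  ext i
  simp [L]

lemma integral_markLaw_slice (hn : 0 < n) (T t : ℝ) (j : Fin n) :
    lam * n * ∫ s in (0 : ℝ)..T, (markLaw n).real
      {m | (s, m) ∈ {q : ℝ × Fin n × ℝ | q.2.1 = j ∧ t < q.1 + q.2.2}} =
      lam * ∫ s in (0 : ℝ)..T, (expMeasure 1).real (Set.Ioi (t - s)) := by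
  have hs : ∀ s : ℝ, {m | (s, m) ∈ {q : ℝ × Fin n × ℝ | q.2.1 = j ∧ t < q.1 + q.2.2}} =
      {m : Fin n × ℝ | m.1 = j ∧ t - s < m.2} := by
    intro s; ext m; simp [sub_lt_iff_lt_add']
  simp_rw [hs, markLaw_real_slice]
  rw [intervalIntegral.integral_div]
  have : (n : ℝ) ≠ 0 := by positivity
  field_simp

lemma lintegral_prod_pow_aliveCount (hlam : 0 < lam) (hn : 0 < n) (h : S.IsOneChoice lam P)
    {T t : ℝ} (hT : 0 ≤ T) (ht : 0 ≤ t) {z : Fin n → ℝ≥0} (hz : ∀ j, z j ≤ 1) :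
    ∫⁻ ω, ∏ j, (z j : ℝ≥0∞) ^ S.aliveCount T t ω j ∂P =
      (∫⁻ ω, ∏ j, (thinned t (z j) : ℝ≥0∞) ^ S.initLoad ω j ∂P) * ENNReal.ofReal (Real.exp
        (∑ j, (lam * ∫ s in (0 : ℝ)..T, (expMeasure 1).real (Set.Ioi (t - s))) * (z j - 1))) := by
  have := isProbabilityMeasure_markLaw hn
  rw [← lintegral_prod_pow_initial h ht]
  have hH : Measurable[S.past 0] fun ω =>
      ∏ j, (z j : ℝ≥0∞) ^ {i : ℕ | i < S.initLoad ω j ∧ t < S.initLife j i ω}.ncard := by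
    refine Finset.measurable_fun_prod _ fun j _ => ?_
    have : Measurable[S.past 0] fun ω =>
        {i : ℕ | i < S.initLoad ω j ∧ t < S.initLife j i ω}.ncard := by
      refine measurable_ncard_setOf fun i => MeasurableSet.inter ?_ ?_
      · have : Measurable[S.past 0] S.initLoad := (comap_measurable S.initLoad).mono
          (S.sigmaAlg_le_past (s := .initLoad) trivial) le_rfl
        exact ((measurable_pi_apply j).comp this) measurableSet_Ioi
      · have : Measurable[S.past 0] (S.initLife j i) := (comap_measurable (S.initLife j i)).mono
          (S.sigmaAlg_le_past (s := .initLife j i) trivial) le_rfl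
        exact this measurableSet_Ioi
    exact (measurable_of_countable fun k : ℕ => (z j : ℝ≥0∞) ^ k).comp this
  have hA : ∀ j : Fin n, MeasurableSet {q : ℝ × Fin n × ℝ | q.2.1 = j ∧ t < q.1 + q.2.2} :=
    fun j => (measurable_snd.fst (measurableSet_singleton j)).inter
      ((measurable_fst.add measurable_snd.snd) measurableSet_Ioi)
  have key := h.isMarkedPoisson.lintegral_mul_prod_pow_count (by positivity) hA
    (fun i j hij => Set.disjoint_left.2 fun q hi hj => hij (hi.1.symm.trans hj.1)) hT hH hz
  simp only [integral_markLaw_slice hn] at key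
  rw [← key]
  refine lintegral_congr fun ω => ?_
  rw [← Finset.prod_mul_distrib]
  refine Finset.prod_congr rfl fun j _ => ?_
  rw [← pow_add]
  rfl

/-- In equilibrium the initial loads are independent Poisson variables. -/
lemma lintegral_prod_pow_initLoad (hlam : 0 < lam) (hn : 0 < n) (h : S.IsOneChoice lam P)
    (heq : S.InEquilibrium P) {z : Fin n → ℝ≥0} (hz : ∀ j, z j ≤ 1) :
    ∫⁻ ω, ∏ j, (z j : ℝ≥0∞) ^ S.initLoad ω j ∂P =
      ENNReal.ofReal (Real.exp (∑ j, lam * (z j - 1))) := by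
  have hexp : Tendsto (fun k : ℕ => Real.exp (-(k : ℝ))) atTop (𝓝 0) :=
    Real.tendsto_exp_neg_atTop_nhds_zero.comp tendsto_natCast_atTop_atTop
  -- Stationarity gives a functional equation: the generating function at z equals its value at the
  -- thinned point times the factor of the new arrivals. As k grows the thinned point tends to 1,
  -- initial balls are forgotten, and only the Poisson factor remains.
  have hk : ∀ k : ℕ, ∫⁻ ω, ∏ j, (z j : ℝ≥0∞) ^ S.initLoad ω j ∂P =
      (∫⁻ ω, ∏ j, (thinned k (z j) : ℝ≥0∞) ^ S.initLoad ω j ∂P) * ENNReal.ofReal (Real.exp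
        (∑ j, (lam * (1 - Real.exp (-(k : ℝ)))) * (z j - 1))) := by
    intro k
    have h1 := lintegral_prod_pow_aliveCount hlam hn h k.cast_nonneg k.cast_nonneg hz
      (T := (k : ℝ)) (t := (k : ℝ))
    rw [integral_survival_of_le k.cast_nonneg le_rfl] at h1
    simp only [sub_self, neg_zero, Real.exp_zero] at h1
    rw [← h1]
    exact (((heq k k.cast_nonneg).comp
      (measurable_of_countable fun x : Fin n → ℕ => ∏ j, (z j : ℝ≥0∞) ^ x j)).lintegral_eq).symm
  have hth : ∀ j, Tendsto (fun k : ℕ => thinned k (z j)) atTop (𝓝 1) := by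
    intro j
    have : Tendsto (fun k : ℕ => 1 + Real.exp (-(k : ℝ)) * ((z j : ℝ) - 1)) atTop (𝓝 1) := by
      simpa using (hexp.mul_const ((z j : ℝ) - 1)).const_add 1
    simpa [thinned] using (tendsto_real_toNNReal this)
  have hlim1 : Tendsto (fun k : ℕ => ∫⁻ ω, ∏ j, (thinned k (z j) : ℝ≥0∞) ^ S.initLoad ω j ∂P)
      atTop (𝓝 (∫⁻ _, 1 ∂P)) := by
    refine tendsto_lintegral_of_dominated_convergence (fun _ => 1)
      (fun k => measurable_prod_pow_initLoad h _) (fun k => ae_of_all _ fun ω => ?_) (by simp)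
      (ae_of_all _ fun ω => ?_)
    · exact Finset.prod_le_one' fun j _ => pow_le_one₀ zero_le
        (by exact_mod_cast thinned_le_one k.cast_nonneg (hz j))
    · have : Tendsto (fun k : ℕ => ∏ j, thinned k (z j) ^ S.initLoad ω j) atTop
          (𝓝 (∏ j : Fin n, 1 ^ S.initLoad ω j)) :=
        tendsto_finsetProd _ fun j _ => (hth j).pow _
      simpa using ENNReal.tendsto_coe.2 this
  have hlim2 : Tendsto (fun k : ℕ => ENNReal.ofReal (Real.exp
        (∑ j, (lam * (1 - Real.exp (-(k : ℝ)))) * (z j - 1)))) atTop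
      (𝓝 (ENNReal.ofReal (Real.exp (∑ j, lam * (z j - 1))))) := by
    refine ENNReal.tendsto_ofReal ((Real.continuous_exp.tendsto _).comp ?_)
    refine tendsto_finsetSum _ fun j _ => ?_
    have := ((hexp.const_sub 1).const_mul lam).mul_const ((z j : ℝ) - 1)
    simpa using this
  have hlim := ENNReal.Tendsto.mul hlim1 (by simp) hlim2 (by simp)
  simp only [← hk] at hlim
  simpa using tendsto_nhds_unique tendsto_const_nhds hlim

/-- The joint law of the numbers of balls that are present up to time `T` and alive at time `t`. -/
theorem map_aliveCount (hlam : 0 < lam) (hn : 0 < n) (h : S.IsOneChoice lam P)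
    (heq : S.InEquilibrium P) {T t : ℝ} (hT : 0 ≤ T) (ht : 0 ≤ t) {r : ℝ≥0}
    (hr : (r : ℝ) = lam * (Real.exp (-t) +
      ∫ s in (0 : ℝ)..T, (expMeasure 1).real (Set.Ioi (t - s)))) :
    P.map (S.aliveCount T t) = Measure.pi fun _ => poissonMeasure r := by
  refine map_eq_pi_poissonMeasure (measurable_aliveCount h T t).aemeasurable (fun _ => r)
    fun z hz => ?_
  rw [lintegral_prod_pow_aliveCount hlam hn h hT ht hz, lintegral_prod_pow_initLoad hlam hn h heq
    (fun j => thinned_le_one ht (hz j)), ← ENNReal.ofReal_mul (Real.exp_pos _).le, ← Real.exp_add,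
    ← Finset.sum_add_distrib]
  congr 2
  refine Finset.sum_congr rfl fun j _ => ?_
  rw [coe_thinned ht, hr]
  ring

/-- A Poisson(λ) population at time T, thinned by survival for a further time t - T. -/
theorem map_aliveCount_of_le (hlam : 0 < lam) (hn : 0 < n) (h : S.IsOneChoice lam P)
    (heq : S.InEquilibrium P) {T t : ℝ} (hT : 0 ≤ T) (hTt : T ≤ t) :
    P.map (S.aliveCount T t) =
      Measure.pi fun _ => poissonMeasure (Real.toNNReal (lam * Real.exp (-(t - T)))) := by
  refine map_aliveCount hlam hn h heq hT (hT.trans hTt) ?_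
  rw [integral_survival_of_le hT hTt, Real.coe_toNNReal _ (by positivity)]
  ring

/-- The Poisson(λ) population at time t together with all newcomers in (t, T], whose later deaths
are ignored. -/
theorem map_aliveCount_of_ge (hlam : 0 < lam) (hn : 0 < n) (h : S.IsOneChoice lam P)
    (heq : S.InEquilibrium P) {T t : ℝ} (ht : 0 ≤ t) (htT : t ≤ T) :
    P.map (S.aliveCount T t) =
      Measure.pi fun _ => poissonMeasure (Real.toNNReal (lam * (1 + (T - t)))) := by
  refine map_aliveCount hlam hn h heq (ht.trans htT) ht ?_
  rw [integral_survival_of_ge ht htT, Real.coe_toNNReal]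
  · ring
  · have : 0 ≤ T - t := by linarith
    positivity

/-- The numbers of balls that arrive during different unit time intervals in the bins and are alive
at the end of the interval are independent Poisson variables. -/
theorem map_freshCount (hlam : 0 < lam) (hn : 0 < n) (h : S.IsOneChoice lam P) (I : ℕ) :
    P.map (fun ω (p : Fin I × Fin n) => S.freshCount I ω p.1 p.2) =
      Measure.pi fun _ => poissonMeasure (Real.toNNReal (lam * (1 - Real.exp (-1)))) := by
  have := isProbabilityMeasure_markLaw hn
  have hexp : Real.exp (-1) ≤ 1 := Real.exp_le_one_iff.2 (by norm_num)
  have hmeas : Measurable (fun ω (p : Fin I × Fin n) => S.freshCount I ω p.1 p.2) :=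
    measurable_of_forall_eval fun p => measurable_freshCount h I p.1 p.2
  refine map_eq_pi_poissonMeasure hmeas.aemeasurable
    (fun _ => Real.toNNReal (lam * (1 - Real.exp (-1)))) fun z hz => ?_
  let A : Fin I × Fin n → Set (ℝ × Fin n × ℝ) := fun p =>
    {q | (p.1 : ℝ) < q.1 ∧ q.1 ≤ (p.1 : ℝ) + 1 ∧ q.2.1 = p.2 ∧ (p.1 : ℝ) + 1 < q.1 + q.2.2}
  have hA : ∀ p, MeasurableSet (A p) := fun p =>
    (measurable_fst measurableSet_Ioi).inter ((measurable_fst measurableSet_Iic).inter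
      ((measurable_snd.fst (measurableSet_singleton p.2)).inter
      ((measurable_fst.add measurable_snd.snd) measurableSet_Ioi)))
  have hdisj : Pairwise fun p p' => Disjoint (A p) (A p') := by
    intro p p' hpp
    refine Set.disjoint_left.2 fun q hq hq' => hpp ?_
    have h1 : (p.1 : ℕ) < p'.1 + 1 := by exact_mod_cast hq.1.trans_le hq'.2.1
    have h2 : (p'.1 : ℕ) < p.1 + 1 := by exact_mod_cast hq'.1.trans_le hq.2.1
    exact Prod.ext (Fin.ext (by omega)) (hq.2.2.1.symm.trans hq'.2.2.1)
  -- Each cell has mean λ times the integral of e^{-(1-s)} over [0, 1]; the arrival rate λn cancels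
  -- the bin probability 1/n.
  have hint : ∀ p : Fin I × Fin n, lam * n * ∫ s in (0 : ℝ)..I, (markLaw n).real {m | (s, m) ∈ A p} =
      lam * (1 - Real.exp (-1)) := by
    intro p
    have hs : ∀ s : ℝ, (markLaw n).real {m | (s, m) ∈ A p} =
        (Set.Ioc (p.1 : ℝ) (p.1 + 1)).indicator
          (fun s => (expMeasure 1).real (Set.Ioi ((p.1 : ℝ) + 1 - s)) / n) s := by
      intro s
      by_cases hs : s ∈ Set.Ioc (p.1 : ℝ) (p.1 + 1)
      · rw [Set.indicator_of_mem hs, ← markLaw_real_slice p.2]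
        congr 1
        ext m
        simp [A, hs.1, hs.2, sub_lt_iff_lt_add']
      · rw [Set.indicator_of_notMem hs]
        have : {m | (s, m) ∈ A p} = ∅ := by
          ext m
          simp only [Set.mem_ofPred_eq, Set.mem_empty_iff_false, iff_false, A]
          exact fun hm => hs ⟨hm.1, hm.2.1⟩
        rw [this]; simp
    simp_rw [hs]
    have hI : (p.1 : ℝ) + 1 ≤ I := by exact_mod_cast p.1.2
    have hp0 : (0 : ℝ) ≤ p.1 := Nat.cast_nonneg _
    rw [intervalIntegral.integral_of_le (Nat.cast_nonneg _),
      setIntegral_indicator measurableSet_Ioc, Set.inter_eq_self_of_subset_right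
        (Set.Ioc_subset_Ioc hp0 hI), ← intervalIntegral.integral_of_le (by linarith),
      intervalIntegral.integral_div]
    have h2 : ∫ s in (p.1 : ℝ)..(p.1 + 1), (expMeasure 1).real (Set.Ioi ((p.1 : ℝ) + 1 - s)) =
        1 - Real.exp (-1) := by
      have := intervalIntegral.integral_comp_add_right (a := 0) (b := 1)
        (fun s => (expMeasure 1).real (Set.Ioi ((p.1 : ℝ) + 1 - s))) (p.1 : ℝ)
      rw [zero_add, add_comm (1 : ℝ)] at this
      rw [← this]
      have h3 := integral_survival_of_le (T := 1) (t := 1) zero_le_one le_rfl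
      simp only [sub_self, neg_zero, Real.exp_zero] at h3
      rw [← h3]
      refine intervalIntegral.integral_congr fun s _ => ?_
      congr 2
      ring
    rw [h2]
    have : (n : ℝ) ≠ 0 := by positivity
    field_simp
  have key := h.isMarkedPoisson.lintegral_mul_prod_pow_count (by positivity) hA hdisj
    (Nat.cast_nonneg I) (@measurable_one _ _ _ (S.past 0) _) hz
  simp only [hint] at key
  simp only [Pi.one_apply, lintegral_one, measure_univ, one_mul] at key
  rw [Real.coe_toNNReal _ (mul_nonneg hlam.le (by linarith)), ← key]
  rfl

end BinSystem

/-! ### Tail bounds for maxima of independent Poisson variables. -/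

section PoissonTails

open scoped ENNReal NNReal

/-- Since (k + i)! ≥ k! i!, the tail is at most r^k/k! times the total mass of the Poisson law. -/
lemma poissonMeasure_Ici_le (r : ℝ≥0) (k : ℕ) :
    poissonMeasure r (Set.Ici k) ≤ ENNReal.ofReal ((r : ℝ) ^ k / k.factorial) := by
  have himg : Set.Ici k = ⋃ i : ℕ, {k + i} := by
    ext x
    simp only [Set.mem_Ici, Set.mem_iUnion, Set.mem_singleton_iff]
    exact le_iff_exists_add
  have hs := ((NormedSpace.expSeries_div_hasSum_exp (r : ℝ)).mul_left (Real.exp (-r))).mul_left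
    ((r : ℝ) ^ k / k.factorial)
  rw [← Real.exp_eq_exp_ℝ, ← Real.exp_add, neg_add_cancel, Real.exp_zero, mul_one] at hs
  calc poissonMeasure r (Set.Ici k) ≤ ∑' i : ℕ, poissonMeasure r {k + i} := by
        rw [himg]; exact measure_iUnion_le _
    _ ≤ ∑' i : ℕ, ENNReal.ofReal
        ((r : ℝ) ^ k / k.factorial * (Real.exp (-r) * ((r : ℝ) ^ i / i.factorial))) := by
        refine ENNReal.tsum_le_tsum fun i => ?_
        rw [poissonMeasure_singleton]
        refine ENNReal.ofReal_le_ofReal ?_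
        have h1 : ((k.factorial * i.factorial : ℕ) : ℝ) ≤ ((k + i).factorial : ℝ) := by
          exact_mod_cast Nat.le_of_dvd (Nat.factorial_pos _) (Nat.factorial_mul_factorial_dvd_factorial_add k i)
        push_cast at h1
        calc Real.exp (-r) * (r : ℝ) ^ (k + i) / (k + i).factorial
            ≤ Real.exp (-r) * (r : ℝ) ^ (k + i) / (k.factorial * i.factorial) := by gcongr
          _ = _ := by rw [pow_add]; field_simp
    _ = _ := by
        rw [← ENNReal.ofReal_tsum_of_nonneg (fun i => by positivity) hs.summable, hs.tsum_eq]

/-- Avoiding the single value k is already unlikely enough; 1 - p ≤ e^{-p} gives a form that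
multiplies well over independent coordinates. -/
lemma poissonMeasure_Iio_le (r : ℝ≥0) (k : ℕ) :
    poissonMeasure r (Set.Iio k) ≤
      ENNReal.ofReal (Real.exp (-(Real.exp (-r) * (r : ℝ) ^ k / k.factorial))) := by
  have h1 : poissonMeasure r (Set.Iio k) ≤ poissonMeasure r {k}ᶜ :=
    measure_mono fun x hx => (ne_of_lt hx : x ≠ k)
  refine h1.trans ?_
  rw [prob_compl_eq_one_sub (measurableSet_singleton k), poissonMeasure_singleton,
    ← ENNReal.ofReal_one, ← ENNReal.ofReal_sub _ (by positivity)]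
  exact ENNReal.ofReal_le_ofReal (Real.one_sub_le_exp_neg _)

variable {Ω ι : Type*} [MeasurableSpace Ω] [Fintype ι] {P : Measure Ω} {X : Ω → ι → ℕ} {r : ℝ≥0}

lemma prob_exists_ge_le (hX : Measurable X) (hlaw : P.map X = Measure.pi fun _ => poissonMeasure r)
    (k : ℕ) : P {ω | ∃ i, k ≤ X ω i} ≤
      ENNReal.ofReal (Fintype.card ι * ((r : ℝ) ^ k / k.factorial)) := by
  have h1 : ∀ i, P {ω | k ≤ X ω i} ≤ ENNReal.ofReal ((r : ℝ) ^ k / k.factorial) := by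
    intro i
    refine le_trans (le_of_eq ?_) (poissonMeasure_Ici_le r k)
    have h2 := (measurePreserving_eval (fun _ : ι => poissonMeasure r) i).map_eq
    rw [← h2, ← hlaw, Measure.map_map (measurable_pi_apply i) hX, Measure.map_apply
      ((measurable_pi_apply i).comp hX) measurableSet_Ici]
    rfl
  have h2 : {ω | ∃ i, k ≤ X ω i} = ⋃ i, {ω | k ≤ X ω i} := by ext; simp
  rw [h2]
  refine (measure_iUnion_fintype_le _ _).trans ((Finset.sum_le_sum fun i _ => h1 i).trans ?_)
  rw [Finset.sum_const, nsmul_eq_mul, ENNReal.ofReal_mul (by positivity)]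
  simp

lemma prob_forall_lt_le (hX : Measurable X) (hlaw : P.map X = Measure.pi fun _ => poissonMeasure r)
    (k : ℕ) : P {ω | ∀ i, X ω i < k} ≤ ENNReal.ofReal
      (Real.exp (-(Fintype.card ι * (Real.exp (-r) * (r : ℝ) ^ k / k.factorial)))) := by
  have h1 : {ω | ∀ i, X ω i < k} = X ⁻¹' (Set.univ.pi fun _ => Set.Iio k) := by ext; simp
  rw [h1, ← Measure.map_apply hX (MeasurableSet.univ_pi fun _ => measurableSet_Iio), hlaw,
    Measure.pi_pi, Finset.prod_const]
  refine (pow_le_pow_left₀ zero_le (poissonMeasure_Iio_le r k) _).trans ?_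
  rw [← ENNReal.ofReal_pow (Real.exp_pos _).le, ← Real.exp_nat_mul]
  refine ENNReal.ofReal_le_ofReal (le_of_eq ?_)
  simp

end PoissonTails

/-! ### Probability bounds for loads at a time and along a path. -/

namespace BinSystem

open scoped ENNReal NNReal

section Path

variable {n : ℕ} {Ω : Type u} {S : BinSystem n Ω} {ω : Ω}

/-- Balls present throughout [s, s'] bound every load in that slot from below. Finiteness of
arrivals is essential, as `Set.ncard` is 0 on infinite sets. -/
lemma aliveCount_le_load (hfin : ∀ T, {k | S.arrival k ω ≤ T}.Finite) {s t s' : ℝ} (hst : s ≤ t)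
    (hts : t ≤ s') (j : Fin n) : S.aliveCount s s' ω j ≤ S.load t ω j := by
  refine Nat.add_le_add (Set.ncard_le_ncard ?_ ?_) (Set.ncard_le_ncard ?_ ?_)
  · exact fun i hi => ⟨hi.1, hts.trans_lt hi.2⟩
  · exact (Set.finite_Iio (S.initLoad ω j)).subset fun i hi => hi.1
  · exact fun k hk => ⟨hk.1.trans hst, hk.2.1, hts.trans_lt hk.2.2⟩
  · exact (hfin t).subset fun k hk => hk.1

lemma load_le_aliveCount (hfin : ∀ T, {k | S.arrival k ω ≤ T}.Finite) {s t s' : ℝ} (hst : s ≤ t)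
    (hts : t ≤ s') (j : Fin n) : S.load t ω j ≤ S.aliveCount s' s ω j := by
  refine Nat.add_le_add (Set.ncard_le_ncard ?_ ?_) (Set.ncard_le_ncard ?_ ?_)
  · exact fun i hi => ⟨hi.1, hst.trans_lt hi.2⟩
  · exact (Set.finite_Iio (S.initLoad ω j)).subset fun i hi => hi.1
  · exact fun k hk => ⟨hk.1.trans hts, hk.2.1, hst.trans_lt hk.2.2⟩
  · exact (hfin s').subset fun k hk => hk.1

lemma freshCount_le_load (hfin : ∀ T, {k | S.arrival k ω ≤ T}.Finite) (T : ℝ) (i : ℕ)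
    (j : Fin n) : S.freshCount T ω i j ≤ S.load (i + 1) ω j := by
  refine le_add_left (Set.ncard_le_ncard ?_ ?_)
  · exact fun k hk => ⟨hk.2.2.1, hk.2.2.2.1, hk.2.2.2.2⟩
  · exact (hfin (i + 1)).subset fun k hk => hk.1

lemma load_le_maxLoad (t : ℝ) (j : Fin n) : S.load t ω j ≤ S.maxLoad t ω :=
  Finset.le_sup (f := S.load t ω) (Finset.mem_univ j)

end Path

variable {n : ℕ} {Ω : Type u} [MeasurableSpace Ω] {S : BinSystem n Ω} {lam : ℝ} {P : Measure Ω}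
  [IsProbabilityMeasure P]

lemma ae_finite_arrivals (hlam : 0 < lam) (hn : 0 < n) (h : S.IsOneChoice lam P) :
    ∀ᵐ ω ∂P, ∀ T, {k | S.arrival k ω ≤ T}.Finite := by
  have := isProbabilityMeasure_markLaw hn
  have h1 : ∀ N : ℕ, ∀ᵐ ω ∂P, {k | S.arrival k ω ≤ N}.Finite := by
    intro N
    filter_upwards [h.isMarkedPoisson.ae_exists_window (by positivity) N.cast_nonneg] with ω ⟨r, hr⟩
    exact (Set.finite_Iio r).subset fun k hk => (hr k).1 hk
  filter_upwards [ae_all_iff.2 h1] with ω hω T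
  obtain ⟨N, hN⟩ := exists_nat_ge T
  exact (hω N).subset fun k hk => le_trans hk hN

lemma map_load (hlam : 0 < lam) (hn : 0 < n) (h : S.IsOneChoice lam P) (heq : S.InEquilibrium P)
    {t : ℝ} (ht : 0 ≤ t) :
    P.map (S.load t) = Measure.pi fun _ => poissonMeasure (Real.toNNReal lam) := by
  have := map_aliveCount_of_le hlam hn h heq ht le_rfl
  simpa [load_eq_aliveCount] using this

/-- Concentration of the maximum load at a fixed time. -/
lemma prob_maxLoad_not_mem_le (hlam : 0 < lam) (hn : 0 < n) (h : S.IsOneChoice lam P)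
    (heq : S.InEquilibrium P) {t : ℝ} (ht : 0 ≤ t) {m : ℕ} (hm : 0 < m) :
    P {ω | ¬ ((S.maxLoad t ω : ℤ) = m ∨ (S.maxLoad t ω : ℤ) = m - 1)} ≤
      ENNReal.ofReal (n * (lam ^ (m + 1) / (m + 1).factorial)) + ENNReal.ofReal
        (Real.exp (-(n * (Real.exp (-lam) * lam ^ (m - 1) / (m - 1).factorial)))) := by
  have hX : Measurable (S.load t) := measurable_aliveCount h t t
  have h1 := prob_exists_ge_le hX (map_load hlam hn h heq ht) (m + 1)
  have h2 := prob_forall_lt_le hX (map_load hlam hn h heq ht) (m - 1)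
  rw [Fintype.card_fin, Real.coe_toNNReal _ hlam.le] at h1 h2
  refine le_trans ((measure_mono ?_).trans (measure_union_le _ _)) (add_le_add h1 h2)
  intro ω hω
  by_contra hc
  simp only [Set.mem_union, not_or, Set.mem_ofPred_eq, not_exists, not_forall, not_lt, not_le] at hc
  obtain ⟨hc1, j, hj⟩ := hc
  have hle : S.maxLoad t ω ≤ m := Finset.sup_le fun j _ => Nat.lt_succ_iff.1 (hc1 j)
  have hge : m - 1 ≤ S.maxLoad t ω := hj.trans (load_le_maxLoad t j)
  exact hω (by omega)

/-- A lower bound for the maximum load during a time interval. -/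
lemma prob_exists_maxLoad_lt_le (hlam : 0 < lam) (hn : 0 < n) (h : S.IsOneChoice lam P)
    (heq : S.InEquilibrium P) {R : ℝ} (hR : 0 ≤ R) {k N : ℕ} (hk : k ≤ N) (hN : 0 < N) :
    P {ω | ¬ ∀ t ∈ Set.Icc 0 R, k ≤ S.maxLoad t ω} ≤ ENNReal.ofReal ((R * N + 1) *
      Real.exp (-(n * (Real.exp (-lam - 1) * lam ^ k / k.factorial)))) := by
  have hN' : (0 : ℝ) < N := by exact_mod_cast hN
  -- The slot [i/N, (i+1)/N] is bad if no bin has k balls that stay through all of it.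
  let E : ℕ → Set Ω := fun i =>
    {ω | ∀ j, S.aliveCount ((i : ℝ) / N) (((i : ℝ) + 1) / N) ω j < k}
  have hE : ∀ i, P (E i) ≤ ENNReal.ofReal
      (Real.exp (-(n * (Real.exp (-lam - 1) * lam ^ k / k.factorial)))) := by
    intro i
    have hle : (i : ℝ) / N ≤ ((i : ℝ) + 1) / N := by gcongr; linarith
    refine (prob_forall_lt_le (measurable_aliveCount h _ _)
      (map_aliveCount_of_le hlam hn h heq (by positivity) hle) k).trans ?_
    refine ENNReal.ofReal_le_ofReal (Real.exp_le_exp.2 (neg_le_neg ?_))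
    rw [Fintype.card_fin, Real.coe_toNNReal _ (by positivity)]
    have h1 : ((i : ℝ) + 1) / N - i / N = 1 / N := by ring
    rw [h1, mul_pow, ← Real.exp_nat_mul, sub_eq_add_neg, Real.exp_add]
    have h2 : Real.exp (-(1 / N : ℝ)) ≤ 1 := Real.exp_le_one_iff.2 (by
      have : (0 : ℝ) < 1 / N := by positivity
      linarith)
    have h3 : Real.exp (-lam) ≤ Real.exp (-(lam * Real.exp (-(1 / N : ℝ)))) :=
      Real.exp_le_exp.2 (by nlinarith)
    -- Thinning multiplies the Poisson mean by e^{-1/N}, hence its k-th power by e^{-k/N}; k ≤ N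
    -- keeps this loss bounded.
    have h4 : Real.exp (-1) ≤ Real.exp (k * (-(1 / N : ℝ))) := by
      refine Real.exp_le_exp.2 ?_
      have : (k : ℝ) / N ≤ 1 := (div_le_one hN').2 (by exact_mod_cast hk)
      rw [mul_neg, mul_one_div]
      linarith
    calc _ = (n : ℝ) * (Real.exp (-lam) * (lam ^ k * Real.exp (-1)) / k.factorial) := by ring
      _ ≤ _ := by gcongr
  have hsub : {ω | ¬ ∀ t ∈ Set.Icc 0 R, k ≤ S.maxLoad t ω} ⊆
      {ω | ¬ ∀ T, {k | S.arrival k ω ≤ T}.Finite} ∪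
        ⋃ i ∈ Finset.range (⌊R * N⌋₊ + 1), E i := by
    intro ω hω
    by_contra hc
    simp only [Set.mem_union, not_or, Set.mem_iUnion, not_exists] at hc
    obtain ⟨hc1, hc2⟩ := hc
    have hfin : ∀ T, {k | S.arrival k ω ≤ T}.Finite := not_not.1 hc1
    refine hω fun t ht => ?_
    have h0 : 0 ≤ t * N := mul_nonneg ht.1 hN'.le
    have hmem : ⌊t * N⌋₊ ∈ Finset.range (⌊R * N⌋₊ + 1) := by
      rw [Finset.mem_range, Nat.lt_succ_iff]
      exact Nat.floor_le_floor (by gcongr; exact ht.2)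
    have hni := hc2 _ hmem
    simp only [E, Set.mem_ofPred_eq, not_forall, not_lt] at hni
    obtain ⟨j, hj⟩ := hni
    refine hj.trans ((aliveCount_le_load hfin ?_ ?_ j).trans (load_le_maxLoad t j))
    · rw [div_le_iff₀ hN']; exact Nat.floor_le h0
    · rw [le_div_iff₀ hN']; exact (Nat.lt_floor_add_one _).le
  refine (measure_mono hsub).trans ((measure_union_le _ _).trans ?_)
  rw [show P {ω | ¬ ∀ T, {k | S.arrival k ω ≤ T}.Finite} = 0 from ae_finite_arrivals hlam hn h,
    zero_add]
  refine (measure_biUnion_finset_le _ _).trans ((Finset.sum_le_sum fun i _ => hE i).trans ?_)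
  rw [Finset.sum_const, Finset.card_range, nsmul_eq_mul, ENNReal.ofReal_mul (by positivity)]
  gcongr
  rw [← ENNReal.ofReal_natCast]
  refine ENNReal.ofReal_le_ofReal ?_
  push_cast
  linarith [Nat.floor_le (show 0 ≤ R * N by positivity)]

/-- An upper bound for the loads during a time interval. -/
lemma prob_exists_load_ge_le (hlam : 0 < lam) (hn : 0 < n) (h : S.IsOneChoice lam P)
    (heq : S.InEquilibrium P) {R : ℝ} (hR : 0 ≤ R) (k : ℕ) :
    P {ω | ¬ ∀ t ∈ Set.Icc 0 R, ∀ j, S.load t ω j < k} ≤ ENNReal.ofReal ((R + 1) *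
      (n * ((2 * lam) ^ k / k.factorial))) := by
  -- Ignoring deaths during a unit slot at most doubles the Poisson mean, and the resulting 2^k is
  -- negligible against k!.
  let E : ℕ → Set Ω := fun i => {ω | ∃ j, k ≤ S.aliveCount ((i : ℝ) + 1) i ω j}
  have hE : ∀ i, P (E i) ≤ ENNReal.ofReal (n * ((2 * lam) ^ k / k.factorial)) := by
    intro i
    have := prob_exists_ge_le (measurable_aliveCount h _ _)
      (map_aliveCount_of_ge hlam hn h heq (Nat.cast_nonneg i)
        (show (i : ℝ) ≤ (i : ℝ) + 1 by linarith)) k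
    rwa [Fintype.card_fin, add_sub_cancel_left, Real.coe_toNNReal _ (by positivity),
      show lam * (1 + 1) = 2 * lam by ring] at this
  have hsub : {ω | ¬ ∀ t ∈ Set.Icc 0 R, ∀ j, S.load t ω j < k} ⊆
      {ω | ¬ ∀ T, {k | S.arrival k ω ≤ T}.Finite} ∪ ⋃ i ∈ Finset.range (⌊R⌋₊ + 1), E i := by
    intro ω hω
    by_contra hc
    simp only [Set.mem_union, not_or, Set.mem_iUnion, not_exists] at hc
    obtain ⟨hc1, hc2⟩ := hc
    have hfin : ∀ T, {k | S.arrival k ω ≤ T}.Finite := not_not.1 hc1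
    refine hω fun t ht j => ?_
    have hmem : ⌊t⌋₊ ∈ Finset.range (⌊R⌋₊ + 1) := by
      rw [Finset.mem_range, Nat.lt_succ_iff]
      exact Nat.floor_le_floor ht.2
    have hni := hc2 _ hmem
    simp only [E, Set.mem_ofPred_eq, not_exists, not_le] at hni
    exact (load_le_aliveCount hfin (Nat.floor_le ht.1) (Nat.lt_floor_add_one t).le j).trans_lt
      (hni j)
  refine (measure_mono hsub).trans ((measure_union_le _ _).trans ?_)
  rw [show P {ω | ¬ ∀ T, {k | S.arrival k ω ≤ T}.Finite} = 0 from ae_finite_arrivals hlam hn h,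
    zero_add]
  refine (measure_biUnion_finset_le _ _).trans ((Finset.sum_le_sum fun i _ => hE i).trans ?_)
  rw [Finset.sum_const, Finset.card_range, nsmul_eq_mul,
    ENNReal.ofReal_mul (p := R + 1) (by positivity)]
  gcongr
  rw [← ENNReal.ofReal_natCast]
  refine ENNReal.ofReal_le_ofReal ?_
  push_cast
  linarith [Nat.floor_le hR]

/-- A lower bound for the maximal load that is attained during a time interval. -/
lemma prob_forall_load_lt_le (hlam : 0 < lam) (hn : 0 < n) (h : S.IsOneChoice lam P)
    {R : ℝ} (hR : 0 ≤ R) (k : ℕ) :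
    P {ω | ¬ ∃ t ∈ Set.Icc 0 R, ∃ j, k ≤ S.load t ω j} ≤ ENNReal.ofReal
      (Real.exp (-(⌊R⌋₊ * n * (Real.exp (-(lam * (1 - Real.exp (-1)))) *
        (lam * (1 - Real.exp (-1))) ^ k / k.factorial)))) := by
  have hexp : Real.exp (-1) ≤ 1 := Real.exp_le_one_iff.2 (by norm_num)
  have hmeas : Measurable (fun ω (p : Fin ⌊R⌋₊ × Fin n) => S.freshCount ⌊R⌋₊ ω p.1 p.2) :=
    measurable_of_forall_eval fun p => measurable_freshCount h _ p.1 p.2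
  -- Independence over both intervals and bins puts the full factor ⌊R⌋n into the exponent.
  have hE := prob_forall_lt_le hmeas (map_freshCount hlam hn h ⌊R⌋₊) k
  rw [Fintype.card_prod, Fintype.card_fin, Fintype.card_fin,
    Real.coe_toNNReal _ (mul_nonneg hlam.le (by linarith)), Nat.cast_mul] at hE
  refine le_trans ((measure_mono ?_).trans ((measure_union_le
    {ω | ¬ ∀ T, {k | S.arrival k ω ≤ T}.Finite}
    {ω | ∀ p : Fin ⌊R⌋₊ × Fin n, S.freshCount ⌊R⌋₊ ω p.1 p.2 < k}).trans ?_)) hE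
  · intro ω hω
    by_contra hc
    simp only [Set.mem_union, not_or] at hc
    obtain ⟨hc1, hc2⟩ := hc
    have hfin : ∀ T, {k | S.arrival k ω ≤ T}.Finite := not_not.1 hc1
    simp only [Set.mem_ofPred_eq, not_forall, not_lt] at hc2
    obtain ⟨⟨i, j⟩, hij⟩ := hc2
    refine hω ⟨(i : ℝ) + 1, ⟨by positivity, ?_⟩, j, hij.trans (freshCount_le_load hfin _ i j)⟩
    have : ((i : ℕ) : ℝ) + 1 ≤ (⌊R⌋₊ : ℝ) := by exact_mod_cast i.2
    exact this.trans (Nat.floor_le hR)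
  · rw [show P {ω | ¬ ∀ T, {k | S.arrival k ω ≤ T}.Finite} = 0 from ae_finite_arrivals hlam hn h,
      zero_add]

end BinSystem

/-! ### Factorials at the scale log n / log log n. -/

section FactorialAsymptotics

lemma tendsto_log_natCast : Tendsto (fun k : ℕ => Real.log k) atTop atTop :=
  Real.tendsto_log_atTop.comp tendsto_natCast_atTop_atTop

/-- The crude bounds k^k e^{-k} ≤ k! ≤ k^k suffice in place of Stirling's formula. -/
lemma tendsto_log_factorial_div :
    Tendsto (fun k : ℕ => Real.log (k.factorial) / (k * Real.log k)) atTop (𝓝 1) := by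
  have h1 : Tendsto (fun k : ℕ => 1 - (Real.log k)⁻¹) atTop (𝓝 1) := by
    simpa using tendsto_log_natCast.inv_tendsto_atTop.const_sub 1
  refine tendsto_of_tendsto_of_tendsto_of_le_of_le' h1 tendsto_const_nhds ?_ ?_
  · filter_upwards [eventually_ge_atTop 2] with k hk
    have hk' : (2 : ℝ) ≤ k := by exact_mod_cast hk
    have hlog : 0 < Real.log k := Real.log_pos (by linarith)
    have hk0 : (0 : ℝ) < k := by linarith
    rw [le_div_iff₀ (by positivity)]
    have h2 : (k : ℝ) ^ k / k.factorial ≤ Real.exp k := Real.pow_div_factorial_le_exp _ hk0.le k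
    have h3 := Real.log_le_log (by positivity) h2
    rw [Real.log_exp, Real.log_div (by positivity) (by positivity), Real.log_pow] at h3
    have : (1 - (Real.log k)⁻¹) * (k * Real.log k) = k * Real.log k - k := by field_simp
    linarith
  · filter_upwards [eventually_ge_atTop 2] with k hk
    have hk' : (2 : ℝ) ≤ k := by exact_mod_cast hk
    have hlog : 0 < Real.log k := Real.log_pos (by linarith)
    have hk0 : (0 : ℝ) < k := by linarith
    rw [div_le_one (by positivity), ← Real.log_pow]
    exact Real.log_le_log (by positivity) (by exact_mod_cast Nat.factorial_le_pow k)

lemma tendsto_log_factorial_div_pow_div (a : ℝ) :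
    Tendsto (fun k : ℕ => (Real.log (k.factorial) - k * Real.log a) / (k * Real.log k))
      atTop (𝓝 1) := by
  have h2 : Tendsto (fun k : ℕ => Real.log a * (Real.log k)⁻¹) atTop (𝓝 0) := by
    simpa using tendsto_log_natCast.inv_tendsto_atTop.const_mul (Real.log a)
  have h := tendsto_log_factorial_div.sub h2
  rw [sub_zero] at h
  refine h.congr' ?_
  filter_upwards [eventually_ge_atTop 2] with k hk
  have hk' : (2 : ℝ) ≤ k := by exact_mod_cast hk
  have hlog : 0 < Real.log k := Real.log_pos (by linarith)
  field_simp

lemma tendsto_loglog_natCast :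
    Tendsto (fun k : ℕ => Real.log (Real.log k)) atTop atTop :=
  Real.tendsto_log_atTop.comp tendsto_log_natCast

lemma tendsto_log_div_self : Tendsto (fun x : ℝ => Real.log x / x) atTop (𝓝 0) := by
  simpa using Real.isLittleO_log_id_atTop.tendsto_div_nhds_zero

/-- The growth rate of the maximum load. -/
noncomputable def logRatio (n : ℕ) : ℝ := Real.log n / Real.log (Real.log n)

lemma tendsto_log_logRatio_div :
    Tendsto (fun n : ℕ => Real.log (logRatio n) / Real.log (Real.log n)) atTop (𝓝 1) := by
  have h := (tendsto_log_div_self.comp tendsto_loglog_natCast).const_sub 1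
  rw [sub_zero] at h
  refine h.congr' ?_
  filter_upwards [tendsto_loglog_natCast.eventually_gt_atTop 0,
    tendsto_log_natCast.eventually_gt_atTop 0] with n h1 h2
  rw [logRatio, Real.log_div h2.ne' h1.ne', sub_div, div_self h1.ne']
  rfl

lemma tendsto_logRatio : Tendsto logRatio atTop atTop := by
  have h : Tendsto (fun n : ℕ => (Real.log (Real.log n) / Real.log n)⁻¹) atTop atTop := by
    refine Tendsto.inv_tendsto_nhdsGT_zero (tendsto_nhdsWithin_iff.2
      ⟨tendsto_log_div_self.comp tendsto_log_natCast, ?_⟩)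
    filter_upwards [tendsto_loglog_natCast.eventually_gt_atTop 0,
      tendsto_log_natCast.eventually_gt_atTop 0] with n h1 h2
    exact div_pos h1 h2
  refine h.congr fun n => ?_
  rw [inv_div]; rfl

/-- The logarithm of `k! / a ^ k` if `k` is of the order of `log n / log log n`. -/
lemma tendsto_log_factorial_div_log {c : ℝ} (hc : 0 < c) {k : ℕ → ℕ} (a : ℝ)
    (hk : Tendsto (fun n => (k n : ℝ) / logRatio n) atTop (𝓝 c)) :
    Tendsto (fun n : ℕ => (Real.log ((k n).factorial) - k n * Real.log a) / Real.log n)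
      atTop (𝓝 c) := by
  have hL0 := tendsto_logRatio.eventually_gt_atTop 0
  have hkr : Tendsto (fun n => (k n : ℝ)) atTop atTop := by
    refine (hk.pos_mul_atTop hc tendsto_logRatio).congr' ?_
    filter_upwards [hL0] with n h
    field_simp
  have hk' : Tendsto k atTop atTop := tendsto_natCast_atTop_iff.1 hkr
  -- The constant c drops out of log k, so log k ~ log log n and k log k ~ c log n.
  have h1 : Tendsto (fun n : ℕ => Real.log (k n) / Real.log (Real.log n)) atTop (𝓝 1) := by
    have h2 : Tendsto (fun n : ℕ => Real.log ((k n : ℝ) / logRatio n) *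
        (Real.log (Real.log n))⁻¹) atTop (𝓝 (Real.log c * 0)) :=
      (hk.log hc.ne').mul tendsto_loglog_natCast.inv_tendsto_atTop
    have h3 := h2.add tendsto_log_logRatio_div
    rw [mul_zero, zero_add] at h3
    refine h3.congr' ?_
    filter_upwards [hL0, hkr.eventually_gt_atTop 0] with n h h'
    rw [Real.log_div h'.ne' h.ne']
    ring
  have h4 := ((tendsto_log_factorial_div_pow_div a).comp hk').mul (hk.mul h1)
  rw [mul_one, one_mul] at h4
  refine h4.congr' ?_
  filter_upwards [hL0, hkr.eventually_gt_atTop 1, tendsto_loglog_natCast.eventually_gt_atTop 0,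
    tendsto_log_natCast.eventually_gt_atTop 0] with n h h' h5 h6
  have h7 : 0 < Real.log (k n) := Real.log_pos h'
  have h8 : (0 : ℝ) < k n := by linarith
  simp only [Function.comp_apply, logRatio]
  field_simp

end FactorialAsymptotics

/-! ### The threshold level and its growth. -/

section Threshold

/-- One plus the typical value of the maximum load. -/
noncomputable def firstRareLevel (lam : ℝ) (n : ℕ) : ℕ :=
  sInf {k : ℕ | n * (lam ^ k * √(k + 1)) < k.factorial}

/-- The typical value of the maximum load. -/
noncomputable def typicalLoad (lam : ℝ) (n : ℕ) : ℕ := firstRareLevel lam n - 1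

variable {lam : ℝ}

/-- Factorials beat (2λ)^k, and the spare 2^k dominates the square root. -/
lemma exists_rareLevel (hlam : 0 < lam) (n : ℕ) :
    ∃ k : ℕ, n * (lam ^ k * √(k + 1)) < k.factorial := by
  have h := FloorSemiring.tendsto_pow_div_factorial_atTop (2 * lam)
  have h2 := (h.const_mul (n : ℝ)).eventually_lt_const (show (n : ℝ) * 0 < 1 by simp)
  obtain ⟨k, hk⟩ := h2.exists
  refine ⟨k, ?_⟩
  have hf : (0 : ℝ) < k.factorial := by positivity
  rw [← mul_div_assoc, div_lt_one hf] at hk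
  refine lt_of_le_of_lt ?_ hk
  rw [mul_pow, mul_comm ((2 : ℝ) ^ k)]
  have h3 : √((k : ℝ) + 1) ≤ 2 ^ k := by
    rw [Real.sqrt_le_left (by positivity)]
    have : k + 1 ≤ (2 ^ k) ^ 2 := (Nat.succ_le_of_lt Nat.lt_two_pow_self).trans
      (Nat.le_self_pow two_ne_zero _)
    exact_mod_cast this
  gcongr

lemma lt_factorial_firstRareLevel (hlam : 0 < lam) (n : ℕ) :
    n * (lam ^ firstRareLevel lam n * √(firstRareLevel lam n + 1)) <
      ((firstRareLevel lam n).factorial : ℝ) :=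
  Nat.sInf_mem (exists_rareLevel hlam n)

/-- At k = 0 the defining inequality would read n < 1. This makes the natural subtraction in
`typicalLoad` exact. -/
lemma firstRareLevel_pos {n : ℕ} (hn : 0 < n) (hlam : 0 < lam) : 0 < firstRareLevel lam n := by
  refine Nat.pos_of_ne_zero fun h => ?_
  have := lt_factorial_firstRareLevel hlam n
  rw [h] at this
  simp at this
  omega

lemma typicalLoad_succ {n : ℕ} (hn : 0 < n) (hlam : 0 < lam) :
    typicalLoad lam n + 1 = firstRareLevel lam n :=
  Nat.sub_add_cancel (firstRareLevel_pos hn hlam)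

lemma factorial_typicalLoad_le {n : ℕ} (hn : 0 < n) (hlam : 0 < lam) :
    ((typicalLoad lam n).factorial : ℝ) ≤
      n * (lam ^ typicalLoad lam n * √(typicalLoad lam n + 1)) := by
  have : typicalLoad lam n < firstRareLevel lam n := by rw [← typicalLoad_succ hn hlam]; omega
  exact not_lt.1 (Nat.notMem_of_lt_sInf this)

lemma lt_factorial_typicalLoad_succ {n : ℕ} (hn : 0 < n) (hlam : 0 < lam) :
    n * (lam ^ (typicalLoad lam n + 1) * √((typicalLoad lam n + 1 : ℕ) + 1)) <
      ((typicalLoad lam n + 1).factorial : ℝ) := by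
  rw [typicalLoad_succ hn hlam]
  exact lt_factorial_firstRareLevel hlam n

/-- Any fixed finite set of levels eventually fails the defining inequality, since its left side
grows linearly in n. -/
lemma tendsto_typicalLoad (hlam : 0 < lam) : Tendsto (typicalLoad lam) atTop atTop := by
  refine tendsto_atTop.2 fun B => ?_
  have h : ∀ᶠ n : ℕ in atTop, ∀ k ∈ Finset.range (B + 1),
      (k.factorial : ℝ) ≤ n * (lam ^ k * √(k + 1)) := by
    rw [Filter.eventually_all_finset]
    intro k _
    have : Tendsto (fun n : ℕ => (n : ℝ) * (lam ^ k * √(k + 1))) atTop atTop :=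
      tendsto_natCast_atTop_atTop.atTop_mul_const (by positivity)
    exact this.eventually_ge_atTop _
  filter_upwards [h, eventually_gt_atTop 0] with n hn hn0
  by_contra hc
  have h1 : typicalLoad lam n + 1 ∈ Finset.range (B + 1) := by
    rw [Finset.mem_range]; omega
  exact absurd (lt_factorial_typicalLoad_succ hn0 hlam) (not_lt.2 (by exact_mod_cast hn _ h1))

lemma tendsto_log_levelRatio (lam : ℝ) : Tendsto (fun k : ℕ =>
    (Real.log k.factorial - k * Real.log lam - Real.log (k + 1) / 2) / (k * Real.log k))
      atTop (𝓝 1) := by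
  have h1 : Tendsto (fun k : ℕ => Real.log (k + 1) / (k + 1) * ((1 + (k : ℝ)⁻¹) / 2) *
      (Real.log k)⁻¹) atTop (𝓝 (0 * ((1 + 0) / 2) * 0)) := by
    have h2 : Tendsto (fun k : ℕ => (k : ℝ) + 1) atTop atTop :=
      tendsto_natCast_atTop_atTop.atTop_add tendsto_const_nhds
    refine ((tendsto_log_div_self.comp h2).mul ?_).mul tendsto_log_natCast.inv_tendsto_atTop
    exact (tendsto_const_nhds.add
      (tendsto_natCast_atTop_atTop (R := ℝ)).inv_tendsto_atTop).div_const _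
  have h := (tendsto_log_factorial_div_pow_div lam).sub h1
  simp only [mul_zero, sub_zero] at h
  refine h.congr' ?_
  filter_upwards [eventually_ge_atTop 2] with k hk
  have hk' : (2 : ℝ) ≤ k := by exact_mod_cast hk
  have hlog : 0 < Real.log k := Real.log_pos (by linarith)
  have hk0 : (0 : ℝ) < k := by linarith
  field_simp

lemma tendsto_succ_mul_log_succ_div : Tendsto (fun k : ℕ =>
    ((k + 1 : ℕ) * Real.log (k + 1 : ℕ)) / (k * Real.log k)) atTop (𝓝 1) := by
  have hinv : Tendsto (fun k : ℕ => 1 + (k : ℝ)⁻¹) atTop (𝓝 1) := by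
    simpa using (tendsto_natCast_atTop_atTop (R := ℝ)).inv_tendsto_atTop.const_add 1
  have h1 : Tendsto (fun k : ℕ => (1 + (k : ℝ)⁻¹) *
      (1 + Real.log (1 + (k : ℝ)⁻¹) * (Real.log k)⁻¹)) atTop (𝓝 (1 * (1 + Real.log 1 * 0))) :=
    hinv.mul (((hinv.log one_ne_zero).mul tendsto_log_natCast.inv_tendsto_atTop).const_add 1)
  simp only [mul_zero, add_zero, mul_one] at h1
  refine h1.congr' ?_
  filter_upwards [eventually_ge_atTop 2] with k hk
  have hk' : (2 : ℝ) ≤ k := by exact_mod_cast hk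
  have hlog : 0 < Real.log k := Real.log_pos (by linarith)
  have hk0 : (0 : ℝ) < k := by linarith
  have h2 : (1 : ℝ) + (k : ℝ)⁻¹ = (k + 1) / k := by field_simp
  rw [h2, Real.log_div (by positivity) hk0.ne']
  push_cast
  field_simp
  ring

/-- The threshold inequality fails at m and holds at m + 1, which traps log n between two quantities
that are both asymptotic to m log m. -/
lemma tendsto_log_div_typicalLoad (hlam : 0 < lam) : Tendsto (fun n : ℕ =>
    Real.log n / (typicalLoad lam n * Real.log (typicalLoad lam n))) atTop (𝓝 1) := by
  have hm := tendsto_typicalLoad hlam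
  have hlow := (tendsto_log_levelRatio lam).comp hm
  have hup := ((tendsto_log_levelRatio lam).comp (tendsto_add_atTop_nat 1)).mul
    tendsto_succ_mul_log_succ_div
  rw [one_mul] at hup
  refine tendsto_of_tendsto_of_tendsto_of_le_of_le' hlow (hup.comp hm) ?_ ?_
  · filter_upwards [eventually_gt_atTop 0, hm.eventually_ge_atTop 2] with n hn hm2
    have h := factorial_typicalLoad_le hn hlam
    simp only [Function.comp_apply]
    set m := typicalLoad lam n
    have hm' : (2 : ℝ) ≤ m := by exact_mod_cast hm2
    have hlog : 0 < Real.log m := Real.log_pos (by linarith)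
    have hn' : (0 : ℝ) < n := by exact_mod_cast hn
    have h2 := Real.log_le_log (by positivity) h
    rw [Real.log_mul (by positivity) (by positivity), Real.log_mul (by positivity) (by positivity),
      Real.log_pow, Real.log_sqrt (by positivity)] at h2
    gcongr
    linarith
  · filter_upwards [eventually_gt_atTop 0, hm.eventually_ge_atTop 2] with n hn hm2
    have h := (lt_factorial_typicalLoad_succ hn hlam).le
    simp only [Function.comp_apply]
    set m := typicalLoad lam n
    have hm' : (2 : ℝ) ≤ m := by exact_mod_cast hm2
    have hlog : 0 < Real.log m := Real.log_pos (by linarith)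
    have hlog' : 0 < Real.log (m + 1 : ℕ) := Real.log_pos (by push_cast; linarith)
    have hn' : (0 : ℝ) < n := by exact_mod_cast hn
    have h2 := Real.log_le_log (by positivity) h
    rw [Real.log_mul (by positivity) (by positivity), Real.log_mul (by positivity) (by positivity),
      Real.log_pow, Real.log_sqrt (by positivity)] at h2
    rw [div_mul_div_cancel₀ (by positivity)]
    gcongr
    linarith

/-- Taking logarithms in log n ~ m log m gives log log n ~ log m; dividing the two relations
isolates m. -/
lemma tendsto_typicalLoad_div_logRatio (hlam : 0 < lam) :
    Tendsto (fun n : ℕ => (typicalLoad lam n : ℝ) / logRatio n) atTop (𝓝 1) := by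
  have hm := tendsto_typicalLoad hlam
  have h1 := tendsto_log_div_typicalLoad hlam
  have hlogm := tendsto_log_natCast.comp hm
  have h2 : Tendsto (fun n : ℕ => Real.log (Real.log n) / Real.log (typicalLoad lam n))
      atTop (𝓝 1) := by
    have h3 := (((h1.log one_ne_zero).mul hlogm.inv_tendsto_atTop).add
      (tendsto_log_div_self.comp hlogm)).const_add 1
    simp only [Real.log_one, zero_mul, add_zero] at h3
    refine h3.congr' ?_
    filter_upwards [hm.eventually_ge_atTop 2, tendsto_log_natCast.eventually_gt_atTop 0]
      with n hm2 hn
    have hm' : (2 : ℝ) ≤ typicalLoad lam n := by exact_mod_cast hm2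
    have hlog : 0 < Real.log (typicalLoad lam n) := Real.log_pos (by linarith)
    have hm0 : (0 : ℝ) < typicalLoad lam n := by linarith
    rw [Real.log_div hn.ne' (by positivity), Real.log_mul hm0.ne' hlog.ne']
    simp only [Function.comp_apply, Pi.inv_apply]
    field_simp
    ring
  have h4 := h2.div h1 one_ne_zero
  rw [div_one] at h4
  refine h4.congr' ?_
  filter_upwards [hm.eventually_ge_atTop 2, tendsto_log_natCast.eventually_gt_atTop 0,
    tendsto_loglog_natCast.eventually_gt_atTop 0] with n hm2 hn hn2
  have hm' : (2 : ℝ) ≤ typicalLoad lam n := by exact_mod_cast hm2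
  have hlog : 0 < Real.log (typicalLoad lam n) := Real.log_pos (by linarith)
  simp only [Pi.div_apply, logRatio]
  field_simp

end Threshold

/-! ### The error probabilities tend to zero. -/

section Bounds

variable {lam : ℝ}

/-- The square root in the threshold is the margin that makes this mean vanish; it splits the gap of
order m between consecutive levels. -/
lemma tendsto_mean_above (hlam : 0 < lam) : Tendsto (fun n : ℕ => (n : ℝ) *
    (lam ^ (typicalLoad lam n + 1) / (typicalLoad lam n + 1).factorial)) atTop (𝓝 0) := by
  have hm := tendsto_typicalLoad hlam
  have hs : Tendsto (fun k : ℕ => (√((k + 1 : ℕ) + 1))⁻¹) atTop (𝓝 0) := by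
    refine (Real.tendsto_sqrt_atTop.comp ?_).inv_tendsto_atTop
    exact (tendsto_natCast_atTop_atTop.comp (tendsto_add_atTop_nat 1)).atTop_add
      tendsto_const_nhds
  refine squeeze_zero' (Eventually.of_forall fun n => by positivity) ?_ (hs.comp hm)
  filter_upwards [eventually_gt_atTop 0] with n hn
  have h := lt_factorial_typicalLoad_succ hn hlam
  simp only [Function.comp_apply]
  rw [← mul_div_assoc, div_le_iff₀ (by positivity), inv_mul_eq_div, le_div_iff₀ (by positivity)]
  linarith

/-- Lower bounds for the expected number of bins with load `typicalLoad lam n - i`. -/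
lemma le_mean_below (hlam : 0 < lam) {n i : ℕ} (hn : 0 < n) (hi : 2 * i ≤ typicalLoad lam n)
    (hm : 0 < typicalLoad lam n) :
    (typicalLoad lam n / 2 / lam : ℝ) ^ i / (2 * √(typicalLoad lam n)) ≤
      n * (lam ^ (typicalLoad lam n - i) / (typicalLoad lam n - i).factorial) := by
  have h := factorial_typicalLoad_le hn hlam
  set m := typicalLoad lam n
  have hm' : (1 : ℝ) ≤ m := by exact_mod_cast hm
  -- Each of the i factors removed from m! is at least m - i ≥ m/2.
  have h1 : ((m : ℝ) / 2) ^ i * (m - i).factorial ≤ m.factorial := by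
    have h2 : (m - i).factorial * (m - i) ^ i ≤ m.factorial := by
      have := Nat.factorial_mul_pow_le_factorial (m := m - i) (n := i)
      rw [Nat.sub_add_cancel (by omega)] at this
      exact (Nat.mul_le_mul_left _ (Nat.pow_le_pow_left (by omega) _)).trans this
    have h3 : (m : ℝ) / 2 ≤ (m - i : ℕ) := by
      rw [Nat.cast_sub (by omega)]
      have : (2 : ℝ) * i ≤ m := by exact_mod_cast hi
      linarith
    calc ((m : ℝ) / 2) ^ i * (m - i).factorial ≤ ((m - i : ℕ) : ℝ) ^ i * (m - i).factorial := by
          gcongr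
      _ ≤ m.factorial := by rw [mul_comm]; exact_mod_cast h2
  have h4 : √((m : ℝ) + 1) ≤ 2 * √m := by
    rw [Real.sqrt_le_left (by positivity), mul_pow, Real.sq_sqrt (by positivity)]
    linarith
  have h5 : lam ^ m = lam ^ (m - i) * lam ^ i := by rw [← pow_add]; congr 1; omega
  rw [div_pow (_ / _), ← mul_div_assoc, div_div, div_le_div_iff₀ (by positivity) (by positivity)]
  calc ((m : ℝ) / 2) ^ i * (m - i).factorial ≤ m.factorial := h1
    _ ≤ n * (lam ^ m * √((m : ℝ) + 1)) := h
    _ ≤ n * (lam ^ m * (2 * √m)) := by gcongr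
    _ = _ := by rw [h5]; ring

lemma tendsto_mean_below (hlam : 0 < lam) : Tendsto (fun n : ℕ => (n : ℝ) *
    (Real.exp (-lam) * lam ^ (typicalLoad lam n - 1) / (typicalLoad lam n - 1).factorial))
      atTop atTop := by
  have hm := tendsto_typicalLoad hlam
  have hs : Tendsto (fun k : ℕ => Real.exp (-lam) * (√k / (4 * lam))) atTop atTop :=
    ((Real.tendsto_sqrt_atTop.comp tendsto_natCast_atTop_atTop).atTop_div_const
      (by positivity)).const_mul_atTop (Real.exp_pos _)
  refine tendsto_atTop_mono' _ ?_ (hs.comp hm)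
  filter_upwards [eventually_gt_atTop 0, hm.eventually_ge_atTop 2] with n hn hm2
  have h := le_mean_below hlam (i := 1) hn (by omega) (by omega)
  simp only [Function.comp_apply]
  set m := typicalLoad lam n
  have hm' : (0 : ℝ) < m := by exact_mod_cast (by omega : 0 < m)
  calc Real.exp (-lam) * (√m / (4 * lam))
      = Real.exp (-lam) * (((m : ℝ) / 2 / lam) ^ 1 / (2 * √m)) := by
        have hsq : √(m : ℝ) * √m = m := Real.mul_self_sqrt hm'.le
        have : √(m : ℝ) ≠ 0 := by positivity
        congr 1
        rw [pow_one, div_eq_div_iff (by positivity) (by positivity)]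
        field_simp
        linear_combination 4 * hsq
    _ ≤ Real.exp (-lam) * (n * (lam ^ (m - 1) / (m - 1).factorial)) := by gcongr
    _ = _ := by ring

/-- The logarithm of the number of slots is of order m log m, while the exponent gained per slot is
at least Cm²; everything is therefore normalised by m². -/
lemma tendsto_path_lower (hlam : 0 < lam) {K : ℝ} (hK : 0 < K) : Tendsto (fun n : ℕ =>
    ((n : ℝ) ^ K * (typicalLoad lam n + 1 : ℕ) + 1) * Real.exp (-(n * (Real.exp (-lam - 1) *
      lam ^ (typicalLoad lam n - 3) / (typicalLoad lam n - 3).factorial)))) atTop (𝓝 0) := by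
  have hm := tendsto_typicalLoad hlam
  have hmr : Tendsto (fun n => (typicalLoad lam n : ℝ)) atTop atTop :=
    tendsto_natCast_atTop_atTop.comp hm
  -- The 16 is 2³ · 2 from `le_mean_below` with i = 3.
  let C : ℝ := Real.exp (-lam - 1) / (16 * lam ^ 3)
  have hC : 0 < C := by positivity
  have hlim : Tendsto (fun n : ℕ => K * (Real.log n / (typicalLoad lam n : ℝ) ^ 2) +
      Real.log (typicalLoad lam n + 2) / (typicalLoad lam n : ℝ) ^ 2 - C) atTop
      (𝓝 (K * 0 + 0 - C)) := by
    have h0 : Tendsto (fun n => Real.log (typicalLoad lam n) / (typicalLoad lam n : ℝ)) atTop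
        (𝓝 0) := tendsto_log_div_self.comp hmr
    refine ((Tendsto.const_mul K ?_).add ?_).sub_const C
    · have h1 := (tendsto_log_div_typicalLoad hlam).mul h0
      rw [mul_zero] at h1
      refine h1.congr' ?_
      filter_upwards [hm.eventually_ge_atTop 2] with n hm2
      have hm' : (2 : ℝ) ≤ typicalLoad lam n := by exact_mod_cast hm2
      have hlog : 0 < Real.log (typicalLoad lam n) := Real.log_pos (by linarith)
      field_simp
    · refine squeeze_zero' (g := fun n => 2 * (Real.log (typicalLoad lam n) / typicalLoad lam n)) ?_ ?_
        (by simpa using h0.const_mul 2)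
      · filter_upwards with n
        refine div_nonneg (Real.log_nonneg ?_) (by positivity)
        have : (0 : ℝ) ≤ typicalLoad lam n := Nat.cast_nonneg _
        linarith
      · filter_upwards [hm.eventually_ge_atTop 2] with n hm2
        have hm' : (2 : ℝ) ≤ typicalLoad lam n := by exact_mod_cast hm2
        have hlog : 0 < Real.log (typicalLoad lam n) := Real.log_pos (by linarith)
        have h2 : Real.log (typicalLoad lam n + 2) ≤ 2 * Real.log (typicalLoad lam n) := by
          rw [← Nat.cast_two, ← Real.log_pow]
          refine Real.log_le_log (by positivity) ?_
          push_cast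
          nlinarith
        rw [div_le_iff₀ (by positivity)]
        refine h2.trans ?_
        have : 2 * (Real.log (typicalLoad lam n) / typicalLoad lam n) * (typicalLoad lam n : ℝ) ^ 2 =
            2 * Real.log (typicalLoad lam n) * typicalLoad lam n := by field_simp
        rw [this]
        nlinarith
  have hbot : Tendsto (fun n : ℕ => Real.exp ((typicalLoad lam n : ℝ) ^ 2 *
      (K * (Real.log n / (typicalLoad lam n : ℝ) ^ 2) +
      Real.log (typicalLoad lam n + 2) / (typicalLoad lam n : ℝ) ^ 2 - C))) atTop (𝓝 0) := by
    refine Real.tendsto_exp_atBot.comp (Tendsto.atTop_mul_neg (C := K * 0 + 0 - C) ?_ ?_ hlim)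
    · linarith
    · exact (tendsto_pow_atTop two_ne_zero).comp hmr
  refine squeeze_zero' (Eventually.of_forall fun n => by positivity) ?_ hbot
  filter_upwards [eventually_gt_atTop 0, hm.eventually_ge_atTop 6] with n hn hm6
  have h := le_mean_below hlam (i := 3) hn (by omega) (by omega)
  set m := typicalLoad lam n
  have hm' : (1 : ℝ) ≤ m := by exact_mod_cast (by omega : 1 ≤ m)
  have hn' : (1 : ℝ) ≤ n := by exact_mod_cast hn
  have h1 : ((n : ℝ) ^ K * (m + 1 : ℕ) + 1) ≤ Real.exp (K * Real.log n + Real.log (m + 2)) := by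
    rw [Real.exp_add, Real.exp_log (by positivity), mul_comm K, ← Real.rpow_def_of_pos (by positivity)]
    have : (1 : ℝ) ≤ (n : ℝ) ^ K := Real.one_le_rpow hn' hK.le
    push_cast
    nlinarith
  -- Weakens the available m^{5/2} to m², which still beats m log m.
  have hsq1 : √(m : ℝ) ≤ m := by
    rw [Real.sqrt_le_left (by positivity)]; nlinarith
  have h2 : C * (m : ℝ) ^ 2 ≤
      n * (Real.exp (-lam - 1) * lam ^ (m - 3) / (m - 3).factorial) := by
    calc C * (m : ℝ) ^ 2 = Real.exp (-lam - 1) * ((m : ℝ) ^ 2 / (16 * lam ^ 3)) := by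
          simp only [C]; ring
      _ ≤ Real.exp (-lam - 1) * (((m : ℝ) / 2 / lam) ^ 3 / (2 * √m)) := by
          refine mul_le_mul_of_nonneg_left ?_ (Real.exp_pos _).le
          rw [div_pow, div_pow, div_div, div_div, div_le_div_iff₀ (by positivity) (by positivity)]
          have : (m : ℝ) ^ 2 * √m ≤ (m : ℝ) ^ 3 := by
            rw [pow_succ (m : ℝ) 2]; gcongr
          calc (m : ℝ) ^ 2 * (2 ^ 3 * (lam ^ 3 * (2 * √m))) = 16 * lam ^ 3 * ((m : ℝ) ^ 2 * √m) := by
                ring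
            _ ≤ 16 * lam ^ 3 * (m : ℝ) ^ 3 := by gcongr
            _ = _ := by ring
      _ ≤ Real.exp (-lam - 1) * (n * (lam ^ (m - 3) / (m - 3).factorial)) := by gcongr
      _ = _ := by ring
  calc _ ≤ Real.exp (K * Real.log n + Real.log (m + 2)) * Real.exp (-(C * (m : ℝ) ^ 2)) := by
        gcongr
    _ = _ := by
        rw [← Real.exp_add]
        congr 1
        field_simp
        ring

lemma tendsto_ceil_mul_logRatio_div {c : ℝ} (hc : 0 < c) :
    Tendsto (fun n => (⌈c * logRatio n⌉₊ : ℝ) / logRatio n) atTop (𝓝 c) :=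
  (tendsto_nat_ceil_mul_div_atTop hc.le).comp tendsto_logRatio

/-- Exposes the mean as a power of n. For k ~ c log n / log log n the exponent of n tends to K + 1 -
c, whose sign decides between the next two limits. -/
lemma rpow_mul_pow_div_factorial {n k : ℕ} (hn : 1 < n) {K a : ℝ} (ha : 0 < a) :
    (n : ℝ) ^ K * (n * (a ^ k / k.factorial)) = Real.exp (Real.log n *
      (K + 1 - (Real.log k.factorial - k * Real.log a) / Real.log n)) := by
  have hn' : (1 : ℝ) < n := by exact_mod_cast hn
  have hlog : 0 < Real.log n := Real.log_pos hn'
  have hf : (0 : ℝ) < k.factorial := by positivity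
  have : Real.log n * (K + 1 - (Real.log k.factorial - k * Real.log a) / Real.log n) =
      Real.log n * K + (Real.log n + (k * Real.log a - Real.log k.factorial)) := by
    field_simp
    ring
  rw [this, Real.exp_add, ← Real.rpow_def_of_pos (by linarith), Real.exp_add,
    Real.exp_log (by linarith), Real.exp_sub, Real.exp_log hf, ← Real.log_pow,
    Real.exp_log (by positivity)]

lemma tendsto_path_upper {a : ℝ} (ha : 0 < a) {K c : ℝ} (hK : 0 < K) (hc : K + 1 < c) :
    Tendsto (fun n : ℕ => ((n : ℝ) ^ K + 1) *
      (n * (a ^ ⌈c * logRatio n⌉₊ / (⌈c * logRatio n⌉₊).factorial))) atTop (𝓝 0) := by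
  have h := (tendsto_log_factorial_div_log (by linarith) a
    (tendsto_ceil_mul_logRatio_div (c := c) (by linarith))).const_sub (K + 1)
  have h1 : Tendsto (fun n : ℕ => 2 * Real.exp (Real.log n * (K + 1 -
      (Real.log (⌈c * logRatio n⌉₊).factorial - ⌈c * logRatio n⌉₊ * Real.log a) / Real.log n)))
      atTop (𝓝 0) := by
    simpa using (Real.tendsto_exp_atBot.comp
      (tendsto_log_natCast.atTop_mul_neg (by linarith) h)).const_mul 2
  refine squeeze_zero' (Eventually.of_forall fun n => by positivity) ?_ h1
  filter_upwards [eventually_gt_atTop 1] with n hn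
  have hn' : (1 : ℝ) ≤ n := by exact_mod_cast hn.le
  have : (1 : ℝ) ≤ (n : ℝ) ^ K := Real.one_le_rpow hn' hK.le
  rw [← rpow_mul_pow_div_factorial hn ha, ← mul_assoc 2]
  gcongr
  linarith

lemma tendsto_path_attained {a b : ℝ} (ha : 0 < a) (hb : 0 < b) {K c : ℝ} (hK : 0 < K) (hc0 : 0 < c)
    (hc : c < K + 1) :
    Tendsto (fun n : ℕ => (⌊(n : ℝ) ^ K⌋₊ : ℝ) * n *
      (b * a ^ ⌈c * logRatio n⌉₊ / (⌈c * logRatio n⌉₊).factorial)) atTop atTop := by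
  have h := (tendsto_log_factorial_div_log hc0 a
    (tendsto_ceil_mul_logRatio_div hc0)).const_sub (K + 1)
  have h1 : Tendsto (fun n : ℕ => b / 2 * Real.exp (Real.log n * (K + 1 -
      (Real.log (⌈c * logRatio n⌉₊).factorial - ⌈c * logRatio n⌉₊ * Real.log a) / Real.log n)))
      atTop atTop :=
    (Real.tendsto_exp_atTop.comp
      (tendsto_log_natCast.atTop_mul_pos (by linarith) h)).const_mul_atTop (by positivity)
  refine tendsto_atTop_mono' _ ?_ h1
  filter_upwards [eventually_gt_atTop 1] with n hn
  have hn' : (1 : ℝ) ≤ n := by exact_mod_cast hn.le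
  have h2 : (1 : ℝ) ≤ (n : ℝ) ^ K := Real.one_le_rpow hn' hK.le
  -- Valid since a real x ≥ 1 satisfies ⌊x⌋ ≥ x/2; the lost factor 2 is harmless.
  have h3 : (n : ℝ) ^ K / 2 ≤ ⌊(n : ℝ) ^ K⌋₊ := by
    have h4 := Nat.lt_floor_add_one ((n : ℝ) ^ K)
    have h5 : (1 : ℝ) ≤ ⌊(n : ℝ) ^ K⌋₊ := by
      exact_mod_cast (Nat.one_le_floor_iff _).2 h2
    linarith
  rw [← rpow_mul_pow_div_factorial hn ha]
  calc _ = (n : ℝ) ^ K / 2 * n * (b * a ^ ⌈c * logRatio n⌉₊ / (⌈c * logRatio n⌉₊).factorial) := by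
        ring
    _ ≤ _ := by gcongr

end Bounds

/-! ### Assembling the theorem. -/

lemma AAS.of_le {Ω : ℕ+ → Type u} [∀ n, MeasurableSpace (Ω n)] {P : ∀ n, Measure (Ω n)}
    {E : ∀ n, Ω n → Prop} {f : ℕ → ℝ} (hf : Tendsto f atTop (𝓝 0))
    (h : ∀ᶠ n : ℕ+ in atTop, P n {ω | ¬ E n ω} ≤ ENNReal.ofReal (f n)) : AAS P E := by
  have h1 : Tendsto (fun n : ℕ+ => ENNReal.ofReal (f n)) atTop (𝓝 0) := by
    simpa using ENNReal.tendsto_ofReal (hf.comp tendsto_PNat_val_atTop_atTop)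
  exact tendsto_of_tendsto_of_tendsto_of_le_of_le' tendsto_const_nhds h1
    (Eventually.of_forall fun n => zero_le) h

theorem theorem1p2 (lam : ℝ) (hlam : 0 < lam) :
    ∃ m : ℕ → ℤ,
      ((fun n : ℕ => (m n : ℝ)) ~[atTop]
        (fun n : ℕ => Real.log (n : ℝ) / Real.log (Real.log (n : ℝ)))) ∧
      ∀ (Ω : ℕ+ → Type u) [∀ n, MeasurableSpace (Ω n)] (P : ∀ n, Measure (Ω n))
        [∀ n, IsProbabilityMeasure (P n)] (S : ∀ n : ℕ+, BinSystem (n : ℕ) (Ω n)),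
        (∀ n, (S n).IsOneChoice lam (P n)) →
        (∀ n, (S n).InEquilibrium (P n)) →
        (∀ t : ℝ, 0 ≤ t →
          AAS P (fun n ω =>
            ((S n).maxLoad t ω : ℤ) = m n ∨ ((S n).maxLoad t ω : ℤ) = m n - 1)) ∧
        (∀ K : ℝ, 0 < K →
          AAS P (fun n ω => ∀ t ∈ Set.Icc (0 : ℝ) ((n : ℝ) ^ K),
            m n - 3 ≤ ((S n).maxLoad t ω : ℤ))) ∧
        (∀ K : ℝ, 0 < K → ∀ ε : ℝ, 0 < ε →
          AAS P (fun n ω => ∃ Z : ℕ,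
            IsGreatest ((fun t : ℝ => (S n).maxLoad t ω) '' Set.Icc (0 : ℝ) ((n : ℝ) ^ K)) Z ∧
            |(Z : ℝ) * (Real.log (Real.log (n : ℝ)) / Real.log (n : ℝ)) - (K + 1)| < ε)) := by
  have hm := tendsto_typicalLoad hlam
  have htoN : Tendsto (fun n : ℕ+ => (n : ℕ)) atTop atTop := tendsto_PNat_val_atTop_atTop
  refine ⟨fun n => typicalLoad lam n, ?_, ?_⟩
  · refine (isEquivalent_iff_tendsto_one ?_).2 ?_
    · filter_upwards [tendsto_logRatio.eventually_gt_atTop 0] with n hn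
      exact hn.ne'
    · exact tendsto_typicalLoad_div_logRatio hlam
  intro Ω _ P _ S hS hE
  refine ⟨fun t ht => ?_, fun K hK => ?_, fun K hK ε hε => ?_⟩
  · have h2 := (tendsto_mean_above hlam).add
      (Real.tendsto_exp_neg_atTop_nhds_zero.comp (tendsto_mean_below hlam))
    rw [add_zero] at h2
    refine AAS.of_le h2 ?_
    filter_upwards [htoN.eventually (hm.eventually_gt_atTop 0)] with n hn
    refine (BinSystem.prob_maxLoad_not_mem_le hlam n.pos (hS n) (hE n) ht hn).trans ?_
    rw [← ENNReal.ofReal_add (by positivity) (Real.exp_pos _).le]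
    rfl
  · refine AAS.of_le (tendsto_path_lower hlam hK) (Eventually.of_forall fun n => ?_)
    -- N = m + 1 is positive and dominates the level. Truncating m - 3 at zero only strengthens the
    -- integer inequality to be shown.
    refine (measure_mono fun ω hω => ?_).trans (BinSystem.prob_exists_maxLoad_lt_le hlam n.pos
      (hS n) (hE n) (R := (n : ℝ) ^ K) (by positivity) (k := typicalLoad lam n - 3)
      (N := typicalLoad lam n + 1) (by omega) (by omega))
    intro hc
    refine hω fun t ht => ?_
    have := hc t ht
    dsimp only
    omega
  · let δ : ℝ := min (ε / 2) (1 / 2)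
    have hδ : 0 < δ := by positivity
    have hδε : δ < ε := (min_le_left _ _).trans_lt (by linarith)
    have hδ1 : δ ≤ 1 / 2 := min_le_right _ _
    have hr : 0 < lam * (1 - Real.exp (-1)) :=
      mul_pos hlam (sub_pos.2 (Real.exp_lt_one_iff.2 (by norm_num)))
    have h2 := (tendsto_path_upper (a := 2 * lam) (c := K + 1 + δ) (by positivity) hK
      (by linarith)).add (Real.tendsto_exp_neg_atTop_nhds_zero.comp (tendsto_path_attained hr
        (Real.exp_pos (-(lam * (1 - Real.exp (-1))))) (c := K + 1 - δ) hK
        (by linarith) (by linarith)))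
    rw [add_zero] at h2
    refine AAS.of_le h2 ?_
    filter_upwards [htoN.eventually (tendsto_logRatio.eventually_gt_atTop 0)] with n hL
    have hup := BinSystem.prob_exists_load_ge_le hlam n.pos (hS n) (hE n)
      (R := (n : ℝ) ^ K) (by positivity) ⌈(K + 1 + δ) * logRatio n⌉₊
    have hlow := BinSystem.prob_forall_load_lt_le hlam n.pos (hS n)
      (R := (n : ℝ) ^ K) (by positivity) ⌈(K + 1 - δ) * logRatio n⌉₊
    refine le_trans ((measure_mono ?_).trans (measure_union_le _ _)) ((add_le_add hup hlow).trans ?_)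
    · intro ω hω
      by_contra hc
      simp only [Set.mem_union, not_or, Set.mem_ofPred_eq, not_not] at hc
      obtain ⟨hc1, t₀, ht₀, j, hj⟩ := hc
      have hu0 : 0 < ⌈(K + 1 + δ) * logRatio n⌉₊ := Nat.ceil_pos.2 (by positivity)
      have hmax : ∀ t ∈ Set.Icc (0 : ℝ) ((n : ℝ) ^ K),
          (S n).maxLoad t ω < ⌈(K + 1 + δ) * logRatio n⌉₊ := fun t ht =>
        (Finset.sup_lt_iff hu0).2 fun j _ => hc1 t ht j
      -- A nonempty bounded set of natural numbers contains its supremum, so the maximum over the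
      -- time interval is attained.
      let A := (fun t : ℝ => (S n).maxLoad t ω) '' Set.Icc (0 : ℝ) ((n : ℝ) ^ K)
      have hbdd : BddAbove A := ⟨⌈(K + 1 + δ) * logRatio n⌉₊, by
        rintro _ ⟨t, ht, rfl⟩; exact (hmax t ht).le⟩
      have hne : A.Nonempty := ⟨_, t₀, ht₀, rfl⟩
      refine hω ⟨sSup A, ⟨Nat.sSup_mem hne hbdd, fun x hx => le_csSup hbdd hx⟩, ?_⟩
      have hZu : ((sSup A : ℕ) : ℝ) < (K + 1 + δ) * logRatio n := by
        obtain ⟨t, ht, htZ⟩ := Nat.sSup_mem hne hbdd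
        rw [← htZ]
        exact Nat.lt_ceil.1 (hmax t ht)
      have hZl : (K + 1 - δ) * logRatio n ≤ ((sSup A : ℕ) : ℝ) := by
        refine Nat.ceil_le.1 (hj.trans ((BinSystem.load_le_maxLoad t₀ j).trans ?_))
        exact le_csSup hbdd ⟨t₀, ht₀, rfl⟩
      have hinv : Real.log (Real.log (n : ℝ)) / Real.log (n : ℝ) = (logRatio n)⁻¹ := by
        rw [logRatio, inv_div]
      change |((sSup A : ℕ) : ℝ) * _ - _| < ε
      rw [hinv, ← div_eq_mul_inv, abs_lt]
      rw [← div_lt_iff₀ hL] at hZu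
      rw [← le_div_iff₀ hL] at hZl
      constructor <;> linarith
    · rw [← ENNReal.ofReal_add (by positivity) (Real.exp_pos _).le]
      rfl
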